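/- Let $\mathcal K$ be a (strict) 2-category. \textbf{Setting.} A 1-cell $x\colon \overline{x}\to\underline{x}$ is \emph{bicarrable} if it has a bipullback along every 1-cell into $\underline{x}$. A class $\mathcal D$ of bicarrable 1-cells is a \emph{display class} if it contains all identities and, for all $x\in\mathcal D$ and $\underline f\colon\underline y\to\underline x$, some bipullback of $x$ along $\underline f$ lies in $\mathcal D$. For a class $\mathcal D$ of 1-cells, $\mathcal K_{\mathcal D}$ is the 2-category whose 0-cells are the elements of $\mathcal D$, whose 1-cells $f\colon y\to x$ are triples $(\overline f\colon\overline y\to\overline x,\ \underline f\colon\underline y\to\underline x,\ x\overline f\cong\underline f y)$, and whose 2-cells are pairs $(\overline\alpha,\underline\alpha)$ of 2-cells compatible with the given isomorphisms. The codomain 2-functor $\mathrm{cod}\colon\mathcal K_{\mathcal D}\to\mathcal K$ takes lower components. A 1-cell or 2-cell of $\mathcal K_{\mathcal D}$ lies over its lower component, and is vertical if that is an identity. \textbf{Fibrational 0-cells.} Let $P\colon\mathcal E\to\mathcal B$ be a 2-functor. A 1-cell $f\colon y\to x$ of $\mathcal E$ is \emph{cartesian} if for every $w$ the functor from $\mathcal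 E(w,y)$ to the isocomma category of $P(f)_*\colon\mathcal B(Pw,Py)\to\mathcal B(Pw,Px)$ and $P_{w,x}\colon\mathcal E(w,x)\to\mathcal B(Pw,Px)$, induced by $P_{w,y}$ and $f_*$, is an equivalence. A 2-cell between 1-cells $y\to x$ is \emph{cartesian} if it is a cartesian morphism for the functor $P_{y,x}$. A 0-cell $e$ of $\mathcal E$ is \emph{fibrational} if (B1) every 1-cell $b'\to P(e)$ has a cartesian lift $e'\to e$; (B2) for every $e'$, the functor $P_{e',e}\colon\mathcal E(e',e)\to\mathcal B(Pe',Pe)$ is a Grothendieck fibration; (B3) whenever $\alpha$ is a cartesian 2-cell between 1-cells $e'\to e$ and $k\colon e''\to e'$ is a 1-cell, the whiskering $\alpha\cdot k$ is cartesian. \textbf{Johnstone criterion.} A 1-cell $x\colon\overline x\to\underline x$ satisfies the \emph{Johnstone criterion} (relative to $\mathcal D$) if $x$ is bicarrable, $x\in\mathcal D$, and the following structure exists. For all $\underline f,\underline g\colon\underline y\to\underline x$, all bipullback squares $f\colon x_f\to x$ over $\underline f$ and $g\colon x_g\to x$ over $\underline g$ with $x_f,x_g\in\mathcal D$, and every 2-cell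 $\underline\alpha\colon\underline f\Rightarrow\underline g$, one is given a vertical 1-cell $r_\alpha\colon x_g\to x_f$ of $\mathcal K_{\mathcal D}$ and (J1) a 2-cell $\alpha\colon f r_\alpha\Rightarrow g$ of $\mathcal K_{\mathcal D}$ over $\underline\alpha$, such that: (J2) for composable $\underline\alpha\colon\underline f\Rightarrow\underline g$ and $\underline\beta\colon\underline g\Rightarrow\underline h$ with composite $\underline\gamma=\underline\beta\,\underline\alpha$, there is a vertical iso-2-cell $\tau\colon r_\alpha r_\beta\Rightarrow r_\gamma$ with $\beta\circ(\alpha\cdot r_\beta)\circ(f\cdot\tau^{-1})=\gamma$; (J3) for each $f$ there is a vertical iso-2-cell $\tau\colon 1_{x_f}\Rightarrow r_{\mathrm{id}_{\underline f}}$ such that $f\cdot\tau^{-1}$ is the given lift of $\mathrm{id}_{\underline f}$; (J4) for $\underline\alpha\colon\underline f\Rightarrow\underline g$, $\underline k\colon\underline z\to\underline y$, bipullback squares $f',g'$ over $\underline f\,\underline k,\underline g\,\underline k$ with $x_{f'},x_{g'}\in\mathcal D$, 1-cells $k_f\colon x_{f'}\to x_f$ and $k_g\colon x_{g'}\to x_g$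 over $\underline k$, and vertical iso-2-cells $\rho\colon fk_f\cong f'$, $\pi\colon gk_g\cong g'$, there is a vertical iso-2-cell $\theta\colon k_f r_{\alpha'}\Rightarrow r_\alpha k_g$ with $\pi\circ(\alpha\cdot k_g)\circ(f\cdot\theta)\circ(\rho^{-1}\cdot r_{\alpha'})=\alpha'$, where $\alpha'\colon f'r_{\alpha'}\Rightarrow g'$ is the given lift of $\underline\alpha\cdot\underline k$; (J5) for vertical 1-cells $v_0\colon y\to x_f$ and $v_1\colon y\to x_g$ of $\mathcal K_{\mathcal D}$ and every 2-cell $\alpha_0\colon fv_0\Rightarrow gv_1$ over $\underline\alpha$, there is a unique vertical 2-cell $\mu\colon v_0\Rightarrow r_\alpha v_1$ with $(\alpha\cdot v_1)\circ(f\cdot\mu)=\alpha_0$. \textbf{Proposition.} Let $\mathcal D$ be either the class of all bicarrable 1-cells of $\mathcal K$ or any display class. A 1-cell $x$ of $\mathcal K$ satisfies the Johnstone criterion relative to $\mathcal D$ if and only if $x$ is a 0-cell of $\mathcal K_{\mathcal D}$ (that is, $x\in\mathcal D$) and is fibrational with respect to $\mathrm{cod}\colon\mathcal K_{\mathcal D}\to\mathcal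 K$. -/

import Mathlib

open CategoryTheory Bicategory

universe w v u w₁ v₁ u₁ w₂ v₂ u₂

namespace JohnstoneFib

/-! ### Bipullbacks and display classes -/

section Bipullbacks

variable {K : Type u} [Bicategory.{w, v} K]

/-- A class of 1-cells of `K`. -/
abbrev CellClass (K : Type u) [Bicategory.{w, v} K] : Type (max u v) :=
  ∀ ⦃a b : K⦄, (a ⟶ b) → Prop

/-- `(P, d₀, d₁, π : f d₀ ≅ g d₁)` is a bipullback of the opspan `A --f--> C <--g-- B`.
(Composition is written in diagrammatic order.) -/
structure IsBipullback {A B C P : K} (f : A ⟶ C) (g : B ⟶ C) (d₀ : P ⟶ A) (d₁ : P ⟶ B)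
    (π : d₀ ≫ f ≅ d₁ ≫ g) : Prop where
  /-- Every iso-cone factors through `P`, up to iso-2-cells that paste correctly. -/
  exists_factor : ∀ {X : K} (l₀ : X ⟶ A) (l₁ : X ⟶ B) (l : l₀ ≫ f ≅ l₁ ≫ g),
    ∃ (t : X ⟶ P) (γ₀ : t ≫ d₀ ≅ l₀) (γ₁ : t ≫ d₁ ≅ l₁),
      t ◁ π.hom ≫ (α_ t d₁ g).inv ≫ γ₁.hom ▷ g =
        (α_ t d₀ f).inv ≫ γ₀.hom ▷ f ≫ l.hom
  /-- Compatible pairs of 2-cells come from a unique 2-cell. -/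
  existsUnique_cell : ∀ {X : K} (s t : X ⟶ P) (a₀ : s ≫ d₀ ⟶ t ≫ d₀) (a₁ : s ≫ d₁ ⟶ t ≫ d₁),
    a₀ ▷ f ≫ (α_ t d₀ f).hom ≫ t ◁ π.hom =
        (α_ s d₀ f).hom ≫ s ◁ π.hom ≫ (α_ s d₁ g).inv ≫ a₁ ▷ g ≫ (α_ t d₁ g).hom →
      ∃! b : s ⟶ t, b ▷ d₀ = a₀ ∧ b ▷ d₁ = a₁

/-- A 1-cell is bicarrable if it has a bipullback along every 1-cell into its codomain. -/
def Bicarrable : CellClass K := fun _ b x =>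
  ∀ ⦃c : K⦄ (f : c ⟶ b), ∃ (p : K) (f' : p ⟶ _) (y : p ⟶ c) (π : f' ≫ x ≅ y ≫ f),
    IsBipullback x f f' y π

/-- A class of display 1-cells: bicarrable 1-cells, containing the identities, and containing
some bipullback of each member along each 1-cell. -/
structure IsDisplayClass (D : CellClass K) : Prop where
  bicarrable : ∀ ⦃a b : K⦄ (x : a ⟶ b), D x → Bicarrable x
  id_mem : ∀ a : K, D (𝟙 a)
  bipullback_mem : ∀ ⦃a b c : K⦄ (x : a ⟶ b) (f : c ⟶ b), D x →
    ∃ (p : K) (f' : p ⟶ a) (y : p ⟶ c) (π : f' ≫ x ≅ y ≫ f), IsBipullback x f f' y π ∧ D y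

end Bipullbacks

/-! ### The 2-category `K_D` -/

section DisplayTwoCategory

variable {K : Type u} [Bicategory.{w, v} K]

/-- The 0-cells of `K_D`: the 1-cells of `K` that belong to the class `D`. -/
structure Disp (D : CellClass K) : Type (max u v) where
  /-- the domain -/
  top : K
  /-- the codomain -/
  bot : K
  /-- the 1-cell itself -/
  arrow : top ⟶ bot
  mem : D arrow

namespace Disp

variable {D : CellClass K}

/-- 1-cells `y ⟶ x` of `K_D`: squares filled by an iso-2-cell. -/
structure Hom (y x : Disp D) : Type (max v w) where
  /-- the 1-cell between the domains -/
  upper : y.top ⟶ x.top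
  /-- the 1-cell between the codomains -/
  lower : y.bot ⟶ x.bot
  /-- the iso-2-cell that fills the square -/
  tri : upper ≫ x.arrow ≅ y.arrow ≫ lower

/-- 2-cells of `K_D`: compatible pairs of an upper and a lower 2-cell. -/
@[ext]
structure Hom₂ {y x : Disp D} (f g : Hom y x) : Type w where
  /-- the 2-cell between the upper 1-cells -/
  upper : f.upper ⟶ g.upper
  /-- the 2-cell between the lower 1-cells -/
  lower : f.lower ⟶ g.lower
  comm : upper ▷ x.arrow ≫ g.tri.hom = f.tri.hom ≫ y.arrow ◁ lower

instance homCategory (y x : Disp D) : Category (Hom y x) where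
  Hom f g := Hom₂ f g
  id f := ⟨𝟙 _, 𝟙 _, by simp⟩
  comp a b := ⟨a.upper ≫ b.upper, a.lower ≫ b.lower, by
    rw [comp_whiskerRight, Category.assoc, b.comm, ← Category.assoc, a.comm, Category.assoc,
      ← whiskerLeft_comp]⟩
  id_comp _ := Hom₂.ext (Category.id_comp _) (Category.id_comp _)
  comp_id _ := Hom₂.ext (Category.comp_id _) (Category.comp_id _)
  assoc _ _ _ := Hom₂.ext (Category.assoc _ _ _) (Category.assoc _ _ _)

section

variable {y x : Disp D}

@[ext]
theorem hom₂_ext {f g : Hom y x} {a b : f ⟶ g} (h₁ : a.upper = b.upper)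
    (h₂ : a.lower = b.lower) : a = b := Hom₂.ext h₁ h₂

@[simp] theorem id_upper (f : Hom y x) : Hom₂.upper (𝟙 f) = 𝟙 f.upper := rfl
@[simp] theorem id_lower (f : Hom y x) : Hom₂.lower (𝟙 f) = 𝟙 f.lower := rfl
@[simp] theorem comp_upper {f g h : Hom y x} (a : f ⟶ g) (b : g ⟶ h) :
    Hom₂.upper (a ≫ b) = a.upper ≫ b.upper := rfl
@[simp] theorem comp_lower {f g h : Hom y x} (a : f ⟶ g) (b : g ⟶ h) :
    Hom₂.lower (a ≫ b) = a.lower ≫ b.lower := rfl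

/-- An invertible 2-cell of `K_D` from invertible upper and lower 2-cells. -/
def mkIso {f g : Hom y x} (a : f.upper ≅ g.upper) (b : f.lower ≅ g.lower)
    (h : a.hom ▷ x.arrow ≫ g.tri.hom = f.tri.hom ≫ y.arrow ◁ b.hom) : f ≅ g where
  hom := ⟨a.hom, b.hom, h⟩
  inv := ⟨a.inv, b.inv, by
    have h' : g.tri.hom = a.inv ▷ x.arrow ≫ f.tri.hom ≫ y.arrow ◁ b.hom := by
      rw [← h]; simp
    rw [h']; simp⟩

@[simp] theorem mkIso_hom_upper {f g : Hom y x} (a : f.upper ≅ g.upper) (b : f.lower ≅ g.lower)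
    (h) : Hom₂.upper (mkIso a b h).hom = a.hom := rfl
@[simp] theorem mkIso_hom_lower {f g : Hom y x} (a : f.upper ≅ g.upper) (b : f.lower ≅ g.lower)
    (h) : Hom₂.lower (mkIso a b h).hom = b.hom := rfl
@[simp] theorem mkIso_inv_upper {f g : Hom y x} (a : f.upper ≅ g.upper) (b : f.lower ≅ g.lower)
    (h) : Hom₂.upper (mkIso a b h).inv = a.inv := rfl
@[simp] theorem mkIso_inv_lower {f g : Hom y x} (a : f.upper ≅ g.upper) (b : f.lower ≅ g.lower)
    (h) : Hom₂.lower (mkIso a b h).inv = b.inv := rfl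

end

/-- The identity square. -/
def idHom (x : Disp D) : Hom x x where
  upper := 𝟙 _
  lower := 𝟙 _
  tri := λ_ _ ≪≫ (ρ_ _).symm

/-- The iso-2-cell obtained by pasting two squares side by side. -/
def pasteIso {a b c a' b' c' : K} {z : a ⟶ a'} {y : b ⟶ b'} {x : c ⟶ c'}
    {k : a ⟶ b} {k' : a' ⟶ b'} {f : b ⟶ c} {f' : b' ⟶ c'}
    (s : k ≫ y ≅ z ≫ k') (t : f ≫ x ≅ y ≫ f') : (k ≫ f) ≫ x ≅ z ≫ (k' ≫ f') :=
  α_ k f x ≪≫ whiskerLeftIso k t ≪≫ (α_ k y f').symm ≪≫ whiskerRightIso s f' ≪≫ α_ z k' f'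

/-- Composition of 1-cells: pasting of squares. -/
def compHom {z y x : Disp D} (k : Hom z y) (f : Hom y x) : Hom z x where
  upper := k.upper ≫ f.upper
  lower := k.lower ≫ f.lower
  tri := pasteIso k.tri f.tri

section

variable {a b c d a' b' c' d' : K} {z : a ⟶ a'} {y : b ⟶ b'} {x : c ⟶ c'} {t : d ⟶ d'}

theorem pasteIso_whiskerLeft {k : a ⟶ b} {k' : a' ⟶ b'} {f g : b ⟶ c} {f' g' : b' ⟶ c'}
    (s : k ≫ y ≅ z ≫ k') (p : f ≫ x ≅ y ≫ f') (q : g ≫ x ≅ y ≫ g')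
    (m : f ⟶ g) (m' : f' ⟶ g') (h : m ▷ x ≫ q.hom = p.hom ≫ y ◁ m') :
    (k ◁ m) ▷ x ≫ (pasteIso s q).hom = (pasteIso s p).hom ≫ z ◁ k' ◁ m' := by
  have e : k ◁ m ▷ x ≫ k ◁ q.hom = k ◁ p.hom ≫ k ◁ y ◁ m' := by
    rw [← whiskerLeft_comp, h, whiskerLeft_comp]
  simp only [pasteIso, Iso.trans_hom, whiskerLeftIso_hom, Iso.symm_hom, whiskerRightIso_hom,
    Category.assoc, whisker_assoc, Iso.inv_hom_id_assoc]
  have e' : k ◁ y ◁ m' ≫ (α_ k y g').inv = (α_ k y f').inv ≫ (k ≫ y) ◁ m' := by simp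
  rw [reassoc_of% e, reassoc_of% e', whisker_exchange_assoc]
  simp

theorem pasteIso_whiskerRight {k l : a ⟶ b} {k' l' : a' ⟶ b'} {f : b ⟶ c} {f' : b' ⟶ c'}
    (s : k ≫ y ≅ z ≫ k') (r : l ≫ y ≅ z ≫ l') (p : f ≫ x ≅ y ≫ f')
    (m : k ⟶ l) (m' : k' ⟶ l') (h : m ▷ y ≫ r.hom = s.hom ≫ z ◁ m') :
    (m ▷ f) ▷ x ≫ (pasteIso r p).hom = (pasteIso s p).hom ≫ z ◁ m' ▷ f' := by
  have e : m ▷ y ▷ f' ≫ r.hom ▷ f' = s.hom ▷ f' ≫ (z ◁ m') ▷ f' := by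
    rw [← comp_whiskerRight, h, comp_whiskerRight]
  have e' : m ▷ f ▷ x ≫ (α_ l f x).hom = (α_ k f x).hom ≫ m ▷ (f ≫ x) := by simp
  have e'' : m ▷ (y ≫ f') ≫ (α_ l y f').inv = (α_ k y f').inv ≫ m ▷ y ▷ f' := by simp
  simp only [pasteIso, Iso.trans_hom, whiskerLeftIso_hom, Iso.symm_hom, whiskerRightIso_hom,
    Category.assoc]
  rw [reassoc_of% e', ← whisker_exchange_assoc, reassoc_of% e'', reassoc_of% e]
  simp

theorem pasteIso_assoc {k : a ⟶ b} {k' : a' ⟶ b'} {f : b ⟶ c} {f' : b' ⟶ c'}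
    {g : c ⟶ d} {g' : c' ⟶ d'}
    (r : k ≫ y ≅ z ≫ k') (s : f ≫ x ≅ y ≫ f') (p : g ≫ t ≅ x ≫ g') :
    (α_ k f g).hom ▷ t ≫ (pasteIso r (pasteIso s p)).hom =
      (pasteIso (pasteIso r s) p).hom ≫ z ◁ (α_ k' f' g').hom := by
  simp only [pasteIso, Iso.trans_hom, whiskerLeftIso_hom, Iso.symm_hom, whiskerRightIso_hom]
  simp only [whiskerLeft_comp, comp_whiskerRight, Category.assoc]
  have e : (α_ k (y) (f' ≫ g')).inv ≫ r.hom ▷ (f' ≫ g') =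
    k ◁ (α_ y f' g').inv ≫ (α_ k (y ≫ f') g').inv ≫ (α_ k y f').inv ▷ g' ≫
      r.hom ▷ f' ▷ g' ≫ (α_ _ f' g').hom := by simp
  rw [reassoc_of% e]
  bicategory

theorem pasteIso_id_left {f : b ⟶ c} {f' : b' ⟶ c'} (p : f ≫ x ≅ y ≫ f') :
    (λ_ f).hom ▷ x ≫ p.hom =
      (pasteIso (λ_ y ≪≫ (ρ_ y).symm) p).hom ≫ y ◁ (λ_ f').hom := by
  simp [pasteIso]

theorem pasteIso_id_right {f : b ⟶ c} {f' : b' ⟶ c'} (p : f ≫ x ≅ y ≫ f') :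
    (ρ_ f).hom ▷ x ≫ p.hom =
      (pasteIso p (λ_ x ≪≫ (ρ_ x).symm)).hom ≫ y ◁ (ρ_ f').hom := by
  simp [pasteIso]

end

/-- Whiskering of 2-cells is done separately on the upper and the lower level. -/
def wL {z y x : Disp D} (k : Hom z y) {f g : Hom y x} (a : f ⟶ g) :
    compHom k f ⟶ compHom k g :=
  ⟨k.upper ◁ a.upper, k.lower ◁ a.lower, pasteIso_whiskerLeft _ _ _ _ _ a.comm⟩

/-- Whiskering of 2-cells is done separately on the upper and the lower level. -/
def wR {z y x : Disp D} {k l : Hom z y} (a : k ⟶ l) (f : Hom y x) :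
    compHom k f ⟶ compHom l f :=
  ⟨a.upper ▷ f.upper, a.lower ▷ f.lower, pasteIso_whiskerRight _ _ _ _ _ a.comm⟩

instance : Bicategory (Disp D) where
  Hom y x := Hom y x
  id x := idHom x
  comp k f := compHom k f
  homCategory y x := homCategory y x
  whiskerLeft k _ _ a := wL k a
  whiskerRight a f := wR a f
  associator f g h := mkIso (α_ f.upper g.upper h.upper) (α_ f.lower g.lower h.lower)
    (pasteIso_assoc _ _ _)
  leftUnitor f := mkIso (λ_ f.upper) (λ_ f.lower) (pasteIso_id_left _)
  rightUnitor f := mkIso (ρ_ f.upper) (ρ_ f.lower) (pasteIso_id_right _)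
  whiskerLeft_id _ _ := Hom₂.ext (whiskerLeft_id _ _) (whiskerLeft_id _ _)
  whiskerLeft_comp _ _ _ _ _ _ := Hom₂.ext (whiskerLeft_comp _ _ _) (whiskerLeft_comp _ _ _)
  id_whiskerLeft _ := Hom₂.ext (id_whiskerLeft _) (id_whiskerLeft _)
  comp_whiskerLeft _ _ _ _ _ := Hom₂.ext (comp_whiskerLeft _ _ _) (comp_whiskerLeft _ _ _)
  id_whiskerRight _ _ := Hom₂.ext (id_whiskerRight _ _) (id_whiskerRight _ _)
  comp_whiskerRight _ _ _ := Hom₂.ext (comp_whiskerRight _ _ _) (comp_whiskerRight _ _ _)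
  whiskerRight_id _ := Hom₂.ext (whiskerRight_id _) (whiskerRight_id _)
  whiskerRight_comp _ _ _ := Hom₂.ext (whiskerRight_comp _ _ _) (whiskerRight_comp _ _ _)
  whisker_assoc _ _ _ _ _ := Hom₂.ext (whisker_assoc _ _ _) (whisker_assoc _ _ _)
  whisker_exchange _ _ := Hom₂.ext (whisker_exchange _ _) (whisker_exchange _ _)
  pentagon _ _ _ _ := Hom₂.ext (pentagon _ _ _ _) (pentagon _ _ _ _)
  triangle _ _ := Hom₂.ext (triangle _ _) (triangle _ _)

/-- An isomorphism of squares with identities as components is an identity. -/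
theorem eq_eqToIso {y x : Disp D} {f g : y ⟶ x} (e : f ≅ g) (h : f = g)
    (h₁ : Hom₂.upper e.hom = eqToHom (congrArg Hom.upper h))
    (h₂ : Hom₂.lower e.hom = eqToHom (congrArg Hom.lower h)) : e = eqToIso h := by
  subst h
  exact Iso.ext (hom₂_ext h₁ h₂)

/-- Two squares are equal if their 1-cells are and their 2-cells agree up to transport. -/
theorem hom_eq {y x : Disp D} {f g : Hom y x} (h₁ : f.upper = g.upper) (h₂ : f.lower = g.lower)
    (h : eqToHom h₁ ▷ x.arrow ≫ g.tri.hom = f.tri.hom ≫ y.arrow ◁ eqToHom h₂) : f = g := by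
  obtain ⟨fu, fl, ft⟩ := f
  obtain ⟨gu, gl, gt⟩ := g
  obtain rfl : fu = gu := h₁
  obtain rfl : fl = gl := h₂
  have : ft = gt := by
    ext
    simpa using h.symm
  rw [this]

/-- If `K` is a 2-category, so is `K_D`. -/
instance [Strict K] : Strict (Disp D) where
  id_comp {y x} f := hom_eq (Strict.id_comp f.upper) (Strict.id_comp f.lower) (by
    have h := pasteIso_id_left f.tri
    rw [Strict.leftUnitor_eqToIso f.upper, Strict.leftUnitor_eqToIso f.lower] at h
    exact h)
  comp_id {y x} f := hom_eq (Strict.comp_id f.upper) (Strict.comp_id f.lower) (by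
    have h := pasteIso_id_right f.tri
    rw [Strict.rightUnitor_eqToIso f.upper, Strict.rightUnitor_eqToIso f.lower] at h
    exact h)
  assoc f g h := hom_eq (Strict.assoc f.upper g.upper h.upper)
    (Strict.assoc f.lower g.lower h.lower) (by
      have e := pasteIso_assoc f.tri g.tri h.tri
      rw [Strict.associator_eqToIso f.upper, Strict.associator_eqToIso f.lower] at e
      exact e)
  leftUnitor_eqToIso f := eq_eqToIso _ _
    (congrArg Iso.hom (Strict.leftUnitor_eqToIso f.upper))
    (congrArg Iso.hom (Strict.leftUnitor_eqToIso f.lower))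
  rightUnitor_eqToIso f := eq_eqToIso _ _
    (congrArg Iso.hom (Strict.rightUnitor_eqToIso f.upper))
    (congrArg Iso.hom (Strict.rightUnitor_eqToIso f.lower))
  associator_eqToIso f g h := eq_eqToIso _ _
    (congrArg Iso.hom (Strict.associator_eqToIso f.upper g.upper h.upper))
    (congrArg Iso.hom (Strict.associator_eqToIso f.lower g.lower h.lower))

/-- The codomain 2-functor `cod : K_D → K`. -/
def cod (D : CellClass K) : StrictPseudofunctor (Disp D) K where
  obj x := x.bot
  map f := Hom.lower f
  map₂ a := Hom₂.lower a
  map₂_id _ := rfl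
  map₂_comp _ _ := rfl
  mapId _ := Iso.refl _
  mapComp _ _ := Iso.refl _
  map₂_whisker_left _ _ _ _ := ((Category.id_comp _).trans (Category.comp_id _)).symm
  map₂_whisker_right _ _ := ((Category.id_comp _).trans (Category.comp_id _)).symm
  map₂_associator f g h := by
    refine Eq.trans ?_ (Category.id_comp _).symm
    refine Eq.trans ?_ (congrArg (· ≫ _) (id_whiskerRight _ _)).symm
    refine Eq.trans ?_ (Category.id_comp _).symm
    refine Eq.trans ?_ (congrArg (_ ≫ ·) ((congrArg (· ≫ _) (whiskerLeft_id _ _)).trans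
      (Category.id_comp _))).symm
    exact (Category.comp_id _).symm
  map₂_left_unitor _ := by
    refine Eq.trans ?_ (Category.id_comp _).symm
    refine Eq.trans ?_ (congrArg (· ≫ _) (id_whiskerRight _ _)).symm
    exact (Category.id_comp _).symm
  map₂_right_unitor _ := by
    refine Eq.trans ?_ (Category.id_comp _).symm
    refine Eq.trans ?_ (congrArg (· ≫ _) (whiskerLeft_id _ _)).symm
    exact (Category.id_comp _).symm
  map_id _ := rfl
  mapId_eq_eqToIso _ := rfl
  map_comp _ _ := rfl
  mapComp_eq_eqToIso _ _ := rfl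

end Disp

end DisplayTwoCategory

/-! ### Cartesian cells and fibrational objects for a 2-functor -/

section Fibrational

open Limits

variable {E : Type u₁} [Bicategory.{w₁, v₁} E] {B : Type u₂} [Bicategory.{w₂, v₂} B]
  (P : StrictPseudofunctor E B)

/-- For `f : y ⟶ x` in `E` and a 0-cell `z`, the functor from `E(z, y)` to the isocomma category
of `P(f)_* : B(Pz, Py) ⥤ B(Pz, Px)` and `P : E(z, x) ⥤ B(Pz, Px)` induced by the commuting square
`P(h) P(f) = P(h f)`. -/
def isocommaComparison {y x : E} (f : y ⟶ x) (z : E) :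
    (z ⟶ y) ⥤ CategoricalPullback (postcomp (P.obj z) (P.map f)) (P.mapFunctor z x) where
  obj h := ⟨P.map h, h ≫ f, (P.mapComp h f).symm⟩
  map a := ⟨P.map₂ a, a ▷ f, by
    simp only [postcomp_map, PrelaxFunctor.mapFunctor_map, P.map₂_whisker_right, Iso.symm_hom]
    exact (Iso.inv_hom_id_assoc _ _).symm⟩
  map_id h := CategoricalPullback.Hom.ext (P.map₂_id h) (id_whiskerRight h f)
  map_comp a b := CategoricalPullback.Hom.ext (P.map₂_comp a b) (comp_whiskerRight a b f)

/-- A 1-cell `f : y ⟶ x` is cartesian with respect to `P` if for every 0-cell `z` the square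
formed by `f_* : E(z, y) ⥤ E(z, x)` and `P(f)_* : B(Pz, Py) ⥤ B(Pz, Px)` is a bipullback of
categories. -/
def IsCartesianOneCell {y x : E} (f : y ⟶ x) : Prop :=
  ∀ z : E, (isocommaComparison P f z).IsEquivalence

/-- A 2-cell is cartesian with respect to `P` if it is a cartesian morphism for the functor `P`
induces on hom-categories. -/
def IsCartesianTwoCell {y x : E} {f g : y ⟶ x} (a : f ⟶ g) : Prop :=
  (P.mapFunctor y x).IsStronglyCartesian ((P.mapFunctor y x).map a) a

/-- A 0-cell `e` of `E` is fibrational with respect to `P : E → B`. -/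
structure IsFibrational (e : E) : Prop where
  /-- Every 1-cell into `P e` has a cartesian lift. -/
  exists_cartesian_lift : ∀ {b : B} (f : b ⟶ P.obj e), ∃ (e' : E) (f' : e' ⟶ e),
    (⟨P.obj e', P.map f'⟩ : Σ c : B, c ⟶ P.obj e) = ⟨b, f⟩ ∧ IsCartesianOneCell P f'
  /-- The functors on hom-categories into `e` are Grothendieck fibrations. -/
  isFibered : ∀ e' : E, (P.mapFunctor e' e).IsFibered
  /-- Whiskering `a ↦ a · k` preserves cartesianness of 2-cells between 1-cells into `e`. -/
  whisker : ∀ {e'' e' : E} (k : e'' ⟶ e') {f g : e' ⟶ e} (a : f ⟶ g),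
    IsCartesianTwoCell P a → IsCartesianTwoCell P (k ◁ a)

end Fibrational

/-! ### The Johnstone criterion -/

section Johnstone

variable {K : Type u} [Bicategory.{w, v} K] {D : CellClass K}

namespace Disp

/-- The 2-cell `a` of `K_D` lies over the 2-cell `φ` of `K`. -/
def LiesOver {y x : Disp D} {f g : y ⟶ x} (a : f ⟶ g) {f' g' : y.bot ⟶ x.bot}
    (φ : f' ⟶ g') : Prop :=
  ∃ (hf : Hom.lower f = f') (hg : Hom.lower g = g'),
    Hom₂.lower a = eqToHom hf ≫ φ ≫ eqToHom hg.symm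

/-- The 2-cell `a` of `K_D` is vertical: it lies over an identity 2-cell. -/
def IsVertical {y x : Disp D} {f g : y ⟶ x} (a : f ⟶ g) : Prop :=
  ∃ h : Hom.lower f = Hom.lower g, Hom₂.lower a = eqToHom h

end Disp

/-- A bipullback `(x_f, f)` in `K` of `x` along `f`, with `x_f` in the class `D`. -/
structure BipullbackAlong (x : Disp D) {b : K} (f : b ⟶ x.bot) where
  /-- the vertex of the bipullback -/
  top : K
  /-- the bipulled back 1-cell `x_f` -/
  arrow : top ⟶ b
  mem : D arrow
  /-- the projection to the domain of `x` -/
  upper : top ⟶ x.top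
  /-- the iso-2-cell of the bipullback square -/
  tri : upper ≫ x.arrow ≅ arrow ≫ f
  isBipullback : IsBipullback x.arrow f upper arrow tri

namespace BipullbackAlong

variable {x : Disp D} {b : K} {f : b ⟶ x.bot}

/-- `x_f` as a 0-cell of `K_D`; its codomain is the domain `b` of `f`. -/
abbrev obj (F : BipullbackAlong x f) : Disp D := ⟨F.top, b, F.arrow, F.mem⟩

/-- The bipullback square as a 1-cell `x_f ⟶ x` of `K_D` over `f`. -/
abbrev cell (F : BipullbackAlong x f) : F.obj ⟶ x := ⟨F.upper, f, F.tri⟩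

end BipullbackAlong

/-- The structure on `x` required by the Johnstone criterion. A 2-cell `a : f ⟶ g` between 1-cells
`f, g : b ⟶ cod x` and bipullbacks `F`, `G` of `x` along `f`, `g` give a vertical 1-cell
`r F G a : x_g ⟶ x_f` and a 2-cell `lift F G a : F r ⟶ G`. -/
structure JohnstoneStructure (x : Disp D) where
  r : ∀ {b : K} {f g : b ⟶ x.bot} (F : BipullbackAlong x f) (G : BipullbackAlong x g)
    (_ : f ⟶ g), G.obj ⟶ F.obj
  r_vertical : ∀ {b : K} {f g : b ⟶ x.bot} (F : BipullbackAlong x f) (G : BipullbackAlong x g)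
    (a : f ⟶ g), Disp.Hom.lower (r F G a) = 𝟙 b
  lift : ∀ {b : K} {f g : b ⟶ x.bot} (F : BipullbackAlong x f) (G : BipullbackAlong x g)
    (a : f ⟶ g), r F G a ≫ F.cell ⟶ G.cell
  /-- The lift of `a` is a 2-cell of `K_D` over `a`. -/
  lift_over : ∀ {b : K} {f g : b ⟶ x.bot} (F : BipullbackAlong x f) (G : BipullbackAlong x g)
    (a : f ⟶ g), Disp.LiesOver (lift F G a) a
  /-- Lifting respects vertical composition of 2-cells, up to a vertical iso-2-cell. -/
  comp : ∀ {b : K} {f g h : b ⟶ x.bot} (F : BipullbackAlong x f) (G : BipullbackAlong x g)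
    (H : BipullbackAlong x h) (a : f ⟶ g) (a' : g ⟶ h),
    ∃ τ : r G H a' ≫ r F G a ≅ r F H (a ≫ a'), Disp.IsVertical τ.hom ∧
      τ.inv ▷ F.cell ≫ (α_ _ _ _).hom ≫ r G H a' ◁ lift F G a ≫ lift G H a' =
        lift F H (a ≫ a')
  /-- Lifting respects identities, up to a vertical iso-2-cell. -/
  id : ∀ {b : K} {f : b ⟶ x.bot} (F : BipullbackAlong x f),
    ∃ τ : 𝟙 F.obj ≅ r F F (𝟙 f), Disp.IsVertical τ.hom ∧
      τ.inv ▷ F.cell ≫ (λ_ F.cell).hom = lift F F (𝟙 f)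
  /-- Lifting respects whiskering with `k : c ⟶ b`, up to a vertical iso-2-cell that pastes
  with `lift F G a` and the comparison iso-2-cells to give the lift of the whiskering. -/
  whisker : ∀ {c b : K} (k : c ⟶ b) {f g : b ⟶ x.bot} (F : BipullbackAlong x f)
    (G : BipullbackAlong x g) (F' : BipullbackAlong x (k ≫ f)) (G' : BipullbackAlong x (k ≫ g))
    (a : f ⟶ g) (kf : F'.obj ⟶ F.obj) (kg : G'.obj ⟶ G.obj),
    Disp.Hom.lower kf = k → Disp.Hom.lower kg = k →
    ∀ (ρ : kf ≫ F.cell ≅ F'.cell) (π : kg ≫ G.cell ≅ G'.cell),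
      Disp.IsVertical ρ.hom → Disp.IsVertical π.hom →
      ∃ θ : r F' G' (k ◁ a) ≫ kf ≅ kg ≫ r F G a, Disp.IsVertical θ.hom ∧
        r F' G' (k ◁ a) ◁ ρ.inv ≫ (α_ _ _ _).inv ≫ θ.hom ▷ F.cell ≫ (α_ _ _ _).hom ≫
          kg ◁ lift F G a ≫ π.hom = lift F' G' (k ◁ a)
  /-- For vertical `v₀`, `v₁`, every 2-cell `F v₀ ⟶ G v₁` over `a` factors through the lift
  of `a` by a unique vertical 2-cell. -/
  factor : ∀ {b : K} {f g : b ⟶ x.bot} (F : BipullbackAlong x f) (G : BipullbackAlong x g)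
    (a : f ⟶ g) {t : K} (y : t ⟶ b) (hy : D y)
    (v₀ : (⟨t, b, y, hy⟩ : Disp D) ⟶ F.obj) (v₁ : (⟨t, b, y, hy⟩ : Disp D) ⟶ G.obj),
    Disp.Hom.lower v₀ = 𝟙 b → Disp.Hom.lower v₁ = 𝟙 b →
    ∀ a₀ : v₀ ≫ F.cell ⟶ v₁ ≫ G.cell, Disp.LiesOver a₀ a →
      ∃! μ : v₀ ⟶ v₁ ≫ r F G a, Disp.IsVertical μ ∧
        μ ▷ F.cell ≫ (α_ _ _ _).hom ≫ v₁ ◁ lift F G a = a₀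

/-- A 1-cell `x` of `K` satisfies the Johnstone criterion, relative to the class `D`: it is
bicarrable, and it is a 0-cell of `K_D` that carries a Johnstone structure. -/
def SatisfiesJohnstone (D : CellClass K) {a b : K} (x : a ⟶ b) : Prop :=
  Bicarrable x ∧ ∃ hx : D x, Nonempty (JohnstoneStructure (⟨a, b, x, hx⟩ : Disp D))

end Johnstone

end JohnstoneFib

/-! Bipullback squares are cartesian 1-cells for `cod`, so (B1) is automatic over a display class.
The bicarrable 1-cells themselves form a display class (`isDisplayClass_bicarrable`), so one
argument serves both choices of `D`. The content is the match between (B2), (B3) and the chosen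
lifts.

If `x` is fibrational, a cartesian lift of `a` with codomain the square `G` has a domain over `f`,
which factors through the bipullback `F`; this yields `r` and `lift`. In each coherence law both
sides are cartesian over the same 2-cell, by (B3) where a whiskering occurs. Hence they differ by a
vertical iso-2-cell, which descends through `F` (`BipullbackAlong.exists_iso_of_isCart`). The
factorization law combines cartesianness of `v₁ ◁ lift` with the 2-dimensional property of `F`.

Conversely, the factorization law tests a lift of `a` only against 2-cells over `a`. To test against
2-cells over `β' ≫ a`, the composition law splits `r` of the composite; so `v₁ ◁ lift` is cartesian
for vertical `v₁` (`isCart_whiskerLeft_lift_of_vertical`). The whiskering law extends this to every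
1-cell (`isCart_whiskerLeft_lift`). Since every 1-cell into `x` factors through a bipullback up to a
vertical iso-2-cell, there are cartesian lifts that stay cartesian under whiskering, and uniqueness
of cartesian lifts passes this stability to all cartesian 2-cells. -/

namespace JohnstoneFib

/-! ### Calculus of vertical 2-cells and of 2-cells over a given 2-cell -/

section Calculus

variable {K : Type u} [Bicategory.{w, v} K] {D : CellClass K}

namespace Disp

@[simp] theorem lower_comp {z y x : Disp D} (k : z ⟶ y) (f : y ⟶ x) :
    Hom.lower (k ≫ f) = Hom.lower k ≫ Hom.lower f := rfl
@[simp] theorem lower_whiskerLeft {z y x : Disp D} (k : z ⟶ y) {f g : y ⟶ x} (a : f ⟶ g) :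
    Hom₂.lower (k ◁ a) = Hom.lower k ◁ Hom₂.lower a := rfl
@[simp] theorem lower_whiskerRight {z y x : Disp D} {k l : z ⟶ y} (a : k ⟶ l) (f : y ⟶ x) :
    Hom₂.lower (a ▷ f) = Hom₂.lower a ▷ Hom.lower f := rfl
@[simp] theorem lower_comp₂ {y x : Disp D} {f g h : y ⟶ x} (a : f ⟶ g) (b : g ⟶ h) :
    Hom₂.lower (a ≫ b) = Hom₂.lower a ≫ Hom₂.lower b := rfl

/-- The invertible lower component of an invertible 2-cell of `K_D`. -/
def lowerIso {y x : Disp D} {f g : y ⟶ x} (e : f ≅ g) : Hom.lower f ≅ Hom.lower g :=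
  ((cod D).mapFunctor y x).mapIso e

@[simp]
theorem lower_hom_inv {y x : Disp D} {f g : y ⟶ x} (e : f ≅ g) :
    Hom₂.lower e.hom ≫ Hom₂.lower e.inv = 𝟙 (Hom.lower f) := (lowerIso e).hom_inv_id

section

variable {z y x : Disp D} {f g h : y ⟶ x}

theorem LiesOver.self (a : f ⟶ g) : LiesOver a (Hom₂.lower a) := ⟨rfl, rfl, by simp⟩

theorem LiesOver.comp {a : f ⟶ g} {b : g ⟶ h} {f' g' h' : y.bot ⟶ x.bot} {φ : f' ⟶ g'}
    {ψ : g' ⟶ h'} (ha : LiesOver a φ) (hb : LiesOver b ψ) : LiesOver (a ≫ b) (φ ≫ ψ) := by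
  obtain ⟨rfl, rfl, ha⟩ := ha
  obtain ⟨_, rfl, hb⟩ := hb
  exact ⟨rfl, rfl, by simp_all⟩

theorem IsVertical.liesOver {a : f ⟶ g} (ha : IsVertical a) {p : y.bot ⟶ x.bot}
    (hp : Hom.lower f = p) : LiesOver a (𝟙 p) := by
  obtain ⟨h, ha⟩ := ha
  subst hp
  exact ⟨rfl, h.symm, by simpa using ha⟩

theorem LiesOver.isVertical {a : f ⟶ g} {p : y.bot ⟶ x.bot} (ha : LiesOver a (𝟙 p)) :
    IsVertical a := by
  obtain ⟨h, h', ha⟩ := ha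
  exact ⟨h.trans h'.symm, by simpa using ha⟩

theorem IsVertical.comp {a : f ⟶ g} {b : g ⟶ h} (ha : IsVertical a) (hb : IsVertical b) :
    IsVertical (a ≫ b) := by
  obtain ⟨_, ha⟩ := ha
  obtain ⟨_, hb⟩ := hb
  exact ⟨by simp_all, by simp [ha, hb]⟩

theorem IsVertical.comp_liesOver {a : f ⟶ g} {b : g ⟶ h} {g' h' : y.bot ⟶ x.bot}
    {ψ : g' ⟶ h'} (ha : IsVertical a) (hb : LiesOver b ψ) : LiesOver (a ≫ b) ψ := by
  have := (ha.liesOver (ha.choose.trans hb.choose)).comp hb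
  rwa [Category.id_comp] at this

theorem LiesOver.comp_isVertical {a : f ⟶ g} {b : g ⟶ h} {f' g' : y.bot ⟶ x.bot}
    {ψ : f' ⟶ g'} (ha : LiesOver a ψ) (hb : IsVertical b) : LiesOver (a ≫ b) ψ := by
  have := ha.comp (hb.liesOver ha.choose_spec.choose)
  rwa [Category.comp_id] at this

theorem IsVertical.inv {e : f ≅ g} (he : IsVertical e.hom) : IsVertical e.inv := by
  obtain ⟨h, he⟩ := he
  refine ⟨h.symm, ?_⟩
  have := lower_hom_inv e
  rw [he] at this
  rw [← cancel_epi (eqToHom h), this]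
  simp

theorem IsVertical.whiskerLeft (k : z ⟶ y) {a : f ⟶ g} (ha : IsVertical a) :
    IsVertical (k ◁ a) := by
  obtain ⟨h, ha⟩ := ha
  exact ⟨by simp [h], by simp [ha, whiskerLeft_eqToHom]⟩

theorem IsVertical.whiskerRight {k l : z ⟶ y} {a : k ⟶ l} (ha : IsVertical a) (f : y ⟶ x) :
    IsVertical (a ▷ f) := by
  obtain ⟨h, ha⟩ := ha
  exact ⟨by simp [h], by simp [ha, eqToHom_whiskerRight]⟩

theorem LiesOver.whiskerLeft {k : z ⟶ y} {k' : z.bot ⟶ y.bot} (hk : Hom.lower k = k')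
    {a : f ⟶ g} {f' g' : y.bot ⟶ x.bot} {φ : f' ⟶ g'} (ha : LiesOver a φ) :
    LiesOver (k ◁ a) (k' ◁ φ) := by
  obtain ⟨rfl, rfl, ha⟩ := ha
  subst hk
  obtain rfl : Hom₂.lower a = φ := by simpa using ha
  exact LiesOver.self (k ◁ a)

section Strict

variable [Strict K]

/-- Structural 2-cells of `K_D` are computed componentwise, and strictness of `K` turns the lower
ones into transports along equalities. -/
theorem isVertical_associator_hom {w : Disp D} (k : w ⟶ z) (l : z ⟶ y) (f : y ⟶ x) :
    IsVertical (α_ k l f).hom :=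
  ⟨Strict.assoc _ _ _, congrArg Iso.hom (Strict.associator_eqToIso _ _ _)⟩

theorem isVertical_associator_inv {w : Disp D} (k : w ⟶ z) (l : z ⟶ y) (f : y ⟶ x) :
    IsVertical (α_ k l f).inv := (isVertical_associator_hom k l f).inv

theorem isVertical_leftUnitor_hom (f : y ⟶ x) : IsVertical (λ_ f).hom :=
  ⟨Strict.id_comp _, congrArg Iso.hom (Strict.leftUnitor_eqToIso _)⟩

/-- Whiskering with an identity conjugates by unitors, which are transports in a strict 2-category.
Thus whiskering with a vertical 1-cell leaves the underlying 2-cell as it was. -/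
theorem LiesOver.id_whiskerLeft {b : K} {t u : K} {s : t ⟶ b} {s' : u ⟶ b} {hs : D s}
    {hs' : D s'} {k : (⟨t, b, s, hs⟩ : Disp D) ⟶ ⟨u, b, s', hs'⟩} (hk : Hom.lower k = 𝟙 b)
    {f g : (⟨u, b, s', hs'⟩ : Disp D) ⟶ x} {a : f ⟶ g} {f' g' : b ⟶ x.bot} {φ : f' ⟶ g'}
    (ha : LiesOver a φ) : LiesOver (k ◁ a) φ := by
  obtain ⟨hf, hg, h⟩ := ha.whiskerLeft hk
  refine ⟨hf.trans (Strict.id_comp _), hg.trans (Strict.id_comp _), ?_⟩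
  rw [h, Bicategory.id_whiskerLeft, Strict.leftUnitor_eqToIso, Strict.leftUnitor_eqToIso]
  simp only [eqToIso.hom, eqToIso.inv, Category.assoc, eqToHom_trans, eqToHom_trans_assoc]

end Strict

end

/-! ### Cartesian 2-cells -/

/-- The universal property of a cartesian 2-cell for `cod`. -/
def IsCart {y x : Disp D} {f g : y ⟶ x} (a : f ⟶ g) : Prop :=
  ∀ (h : y ⟶ x) (c : h ⟶ g) (b : Hom.lower h ⟶ Hom.lower f), Hom₂.lower c = b ≫ Hom₂.lower a →
    ∃! χ : h ⟶ f, Hom₂.lower χ = b ∧ χ ≫ a = c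

section

variable {z y x : Disp D} {f g h : y ⟶ x}

theorem isHomLift_iff_liesOver {f' g' : y.bot ⟶ x.bot} (φ : f' ⟶ g') (a : f ⟶ g) :
    ((cod D).mapFunctor y x).IsHomLift φ a ↔ LiesOver a φ := by
  constructor
  · intro H
    exact ⟨@IsHomLift.domain_eq _ _ _ _ ((cod D).mapFunctor y x) _ _ _ _ φ a H,
      @IsHomLift.codomain_eq _ _ _ _ ((cod D).mapFunctor y x) _ _ _ _ φ a H,
      @IsHomLift.fac' _ _ _ _ ((cod D).mapFunctor y x) _ _ _ _ φ a H⟩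
  · rintro ⟨hf, hg, h⟩
    exact IsHomLift.of_fac' ((cod D).mapFunctor y x) φ a hf hg h

theorem LiesOver.lower_eq {a : f ⟶ g} {φ : Hom.lower f ⟶ Hom.lower g} (ha : LiesOver a φ) :
    Hom₂.lower a = φ := by
  obtain ⟨_, _, ha⟩ := ha
  simpa using ha

/-- Absorbs the transport that appears when the domain of `a` lies over `f'` only up to a
propositional equality. -/
theorem LiesOver.of_lower_eq_comp {a : f ⟶ g} {f' g' : y.bot ⟶ x.bot} {φ : f' ⟶ g'}
    (ha : LiesOver a φ) (hf : Hom.lower f = f') {c : h ⟶ g} {β : Hom.lower h ⟶ f'}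
    (hc : Hom₂.lower c = (β ≫ eqToHom hf.symm) ≫ Hom₂.lower a) : LiesOver c (β ≫ φ) := by
  obtain ⟨rfl, rfl, -⟩ := id ha
  obtain rfl := ha.lower_eq
  exact ⟨rfl, rfl, by simpa using hc⟩

/-- Once the endpoints are substituted, being a lift of `φ` is an equation between lower components,
and the two universal properties coincide. -/
theorem isStronglyCartesian_iff {f' g' : y.bot ⟶ x.bot} (φ : f' ⟶ g') (a : f ⟶ g) :
    ((cod D).mapFunctor y x).IsStronglyCartesian φ a ↔ LiesOver a φ ∧ IsCart a := by
  constructor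
  · intro H
    have hl : LiesOver a φ := (isHomLift_iff_liesOver φ a).1 H.toIsHomLift
    refine ⟨hl, ?_⟩
    obtain ⟨rfl, rfl, -⟩ := id hl
    obtain rfl := hl.lower_eq
    intro h c b hc
    obtain ⟨χ, ⟨h₁, h₂⟩, hu⟩ := @H.universal_property' _ b c
      ((isHomLift_iff_liesOver (b ≫ Hom₂.lower a) c).2 (hc ▸ LiesOver.self c))
    refine ⟨χ, ⟨((isHomLift_iff_liesOver _ _).1 h₁).lower_eq, h₂⟩, ?_⟩
    rintro χ' ⟨rfl, h₂'⟩
    exact hu χ' ⟨(isHomLift_iff_liesOver _ _).2 (LiesOver.self χ'), h₂'⟩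
  · rintro ⟨hl, H⟩
    obtain ⟨rfl, rfl, -⟩ := id hl
    obtain rfl := hl.lower_eq
    refine { toIsHomLift := (isHomLift_iff_liesOver _ _).2 hl, universal_property' := ?_ }
    intro h b c hc
    obtain ⟨χ, ⟨h₁, h₂⟩, hu⟩ := H h c b ((isHomLift_iff_liesOver _ _).1 hc).lower_eq
    refine ⟨χ, ⟨(isHomLift_iff_liesOver _ _).2 (h₁ ▸ LiesOver.self χ), h₂⟩, ?_⟩
    rintro χ' ⟨h₁', h₂'⟩
    exact hu χ' ⟨((isHomLift_iff_liesOver _ _).1 h₁').lower_eq, h₂'⟩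

theorem isCartesianTwoCell_iff (a : f ⟶ g) : IsCartesianTwoCell (cod D) a ↔ IsCart a :=
  (isStronglyCartesian_iff (Hom₂.lower a) a).trans (and_iff_right (LiesOver.self a))

theorem IsCart.comp {a : f ⟶ g} {b : g ⟶ h} (ha : IsCart a) (hb : IsCart b) :
    IsCart (a ≫ b) := by
  intro k c φ hc
  obtain ⟨χ, ⟨h₁, h₂⟩, hu⟩ := hb k c (φ ≫ Hom₂.lower a) (by rw [hc]; simp)
  obtain ⟨ξ, ⟨h₁', h₂'⟩, hu'⟩ := ha k χ φ h₁
  refine ⟨ξ, ⟨h₁', by rw [← Category.assoc, h₂', h₂]⟩, ?_⟩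
  rintro ξ' ⟨k₁, k₂⟩
  exact hu' ξ' ⟨k₁, hu _ ⟨by simp [k₁], by simpa using k₂⟩⟩

theorem IsCart.of_isIso (e : f ≅ g) : IsCart e.hom := by
  intro k c φ hc
  refine ⟨c ≫ e.inv, ⟨by simp [hc], by simp⟩, ?_⟩
  rintro ξ ⟨_, rfl⟩
  simp

/-- The universal property of a cartesian 2-cell, relative to 2-cells of `K` given up to
equality of their domains and codomains. -/
theorem IsCart.existsUnique {a : f ⟶ g} (ha : IsCart a) {f' g' h' : y.bot ⟶ x.bot}
    {φ : f' ⟶ g'} (hφ : LiesOver a φ) (c : h ⟶ g) (b : h' ⟶ f') (hc : LiesOver c (b ≫ φ)) :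
    ∃! χ : h ⟶ f, LiesOver χ b ∧ χ ≫ a = c := by
  obtain ⟨rfl, rfl, hφ⟩ := hφ
  obtain ⟨rfl, _, hc⟩ := hc
  obtain rfl : Hom₂.lower a = φ := by simpa using hφ
  obtain ⟨χ, ⟨h₁, h₂⟩, hu⟩ := ha h c b (by simpa using hc)
  subst h₁
  refine ⟨χ, ⟨LiesOver.self χ, h₂⟩, ?_⟩
  rintro χ' ⟨⟨_, _, k₁⟩, k₂⟩
  exact hu χ' ⟨by simpa using k₁, k₂⟩

/-- Cartesian lifts are unique up to a vertical iso-2-cell. -/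
theorem IsCart.exists_iso {a : f ⟶ h} {b : g ⟶ h} (ha : IsCart a) (hb : IsCart b)
    {f' h' : y.bot ⟶ x.bot} {φ : f' ⟶ h'} (hφ : LiesOver a φ) (hφ' : LiesOver b φ) :
    ∃ e : f ≅ g, IsVertical e.hom ∧ e.hom ≫ b = a := by
  obtain ⟨s, ⟨hs, hs'⟩, -⟩ := hb.existsUnique hφ' a (𝟙 _) (by simpa using hφ)
  obtain ⟨t, ⟨ht, ht'⟩, -⟩ := ha.existsUnique hφ b (𝟙 _) (by simpa using hφ')
  refine ⟨⟨s, t, ?_, ?_⟩, hs.isVertical, hs'⟩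
  · refine (ha.existsUnique hφ a (𝟙 _) (by simpa using hφ)).unique
      ⟨by simpa using hs.comp ht, by simp [ht', hs']⟩ ⟨?_, by simp⟩
    exact IsVertical.liesOver ⟨rfl, rfl⟩ hφ.choose
  · refine (hb.existsUnique hφ' b (𝟙 _) (by simpa using hφ')).unique
      ⟨by simpa using ht.comp hs, by simp [ht', hs']⟩ ⟨?_, by simp⟩
    exact IsVertical.liesOver ⟨rfl, rfl⟩ hφ'.choose

end

end Disp

end Calculus

/-! ### Pasted squares and the compatibility condition of a bipullback -/

section Pasting

variable {K : Type u} [Bicategory.{w, v} K]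

/-- Turns the compatibility equation of a 2-cell of `K_D` between composites with a bipullback
square into the input of `IsBipullback.existsUnique_cell`. The second member of the pair is `z ◁ β`
conjugated by the fillers. -/
theorem whiskerRight_compat_of_pasteIso {A B C P Z Z' : K} {x : A ⟶ B} {f : C ⟶ B}
    {d₀ : P ⟶ A} {d₁ : P ⟶ C} {π : d₀ ≫ x ≅ d₁ ≫ f} {s t : Z ⟶ P} {z : Z ⟶ Z'} {k l : Z' ⟶ C}
    {σ : s ≫ d₁ ≅ z ≫ k} {τ : t ≫ d₁ ≅ z ≫ l} {β : k ⟶ l} {m : s ≫ d₀ ⟶ t ≫ d₀}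
    (h : m ▷ x ≫ (Disp.pasteIso τ π).hom = (Disp.pasteIso σ π).hom ≫ z ◁ β ▷ f) :
    m ▷ x ≫ (α_ t d₀ x).hom ≫ t ◁ π.hom = (α_ s d₀ x).hom ≫ s ◁ π.hom ≫ (α_ s d₁ f).inv ≫
      (σ.hom ≫ z ◁ β ≫ τ.inv) ▷ f ≫ (α_ t d₁ f).hom := by
  have e : z ◁ β ▷ f = (α_ _ _ _).inv ≫ (z ◁ β) ▷ f ≫ (α_ _ _ _).hom := by simp
  rw [e] at h
  simp only [Disp.pasteIso, Iso.trans_hom, whiskerLeftIso_hom, Iso.symm_hom, whiskerRightIso_hom,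
    Category.assoc, Iso.hom_inv_id_assoc] at h
  rw [← cancel_mono ((α_ t d₁ f).inv ≫ τ.hom ▷ f ≫ (α_ z l f).hom)]
  simp only [comp_whiskerRight, Category.assoc, Iso.hom_inv_id_assoc,
    inv_hom_whiskerRight_assoc]
  exact h

end Pasting

/-! ### Bipullbacks as cartesian 1-cells -/

namespace BipullbackAlong

open Disp

variable {K : Type u} [Bicategory.{w, v} K] {D : CellClass K} {x : Disp D} {b : K}
  {f : b ⟶ x.bot}

/-- Pasting the filler of `h` with `β` gives an iso-cone on `h.upper` and `z.arrow ≫ k`. The second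
comparison iso of its factorization serves as the filler of the new square, so the lower 1-cell can
be exactly `k`. -/
theorem exists_lift_of_iso (F : BipullbackAlong x f) {z : Disp D} (h : z ⟶ x) (k : z.bot ⟶ b)
    (β : k ≫ f ≅ Hom.lower h) :
    ∃ (t : z ⟶ F.obj) (ht : Hom.lower t = k) (e : t ≫ F.cell ≅ h),
      Hom₂.lower e.hom = eqToHom (by simp [ht]) ≫ β.hom := by
  obtain ⟨t, γ₀, γ₁, H⟩ := F.isBipullback.exists_factor (Hom.upper h) (z.arrow ≫ k)
    (Hom.tri h ≪≫ (whiskerLeftIso z.arrow β).symm ≪≫ (α_ _ _ _).symm)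
  have he : γ₀.hom ▷ x.arrow ≫ (Hom.tri h).hom = (pasteIso γ₁ F.tri).hom ≫ z.arrow ◁ β.hom := by
    simp only [pasteIso, Iso.trans_hom, whiskerLeftIso_hom, Iso.symm_hom, whiskerRightIso_hom,
      Category.assoc] at H ⊢
    rw [reassoc_of% H]
    simp
  let t' : z ⟶ F.obj := ⟨t, k, γ₁⟩
  let e : t' ≫ F.cell ≅ h := mkIso γ₀ β he
  exact ⟨t', rfl, e, (Category.id_comp _).symm⟩

theorem exists_lift (F : BipullbackAlong x f) {z : Disp D} (h : z ⟶ x) (k : z.bot ⟶ b)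
    (hk : Hom.lower h = k ≫ f) :
    ∃ (t : z ⟶ F.obj) (e : t ≫ F.cell ≅ h), Hom.lower t = k ∧ IsVertical e.hom := by
  obtain ⟨t, ht, e, he⟩ := F.exists_lift_of_iso h k (eqToIso hk.symm)
  exact ⟨t, e, ht, by simp [ht, hk], by rw [he]; exact eqToHom_trans _ hk.symm⟩

/-- Compatibility with the fillers forces the whiskering of the upper component with `F.arrow` to be
the conjugate of `z.arrow ◁ β`; the whiskering with `F.upper` is that of `m`. The bipullback then
determines the upper component. -/
theorem existsUnique_cell (F : BipullbackAlong x f) {z : Disp D} (s t : z ⟶ F.obj)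
    (m : s ≫ F.cell ⟶ t ≫ F.cell) (β : Hom.lower s ⟶ Hom.lower t)
    (hm : Hom₂.lower m = β ▷ f) : ∃! μ : s ⟶ t, Hom₂.lower μ = β ∧ μ ▷ F.cell = m := by
  have hc : Hom₂.upper m ▷ x.arrow ≫ (pasteIso (Hom.tri t) F.tri).hom =
    (pasteIso (Hom.tri s) F.tri).hom ≫ z.arrow ◁ Hom₂.lower m := m.comm
  rw [hm] at hc
  obtain ⟨μ, ⟨h₀, h₁⟩, hu⟩ := F.isBipullback.existsUnique_cell (Hom.upper s) (Hom.upper t)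
    (Hom₂.upper m) ((Hom.tri s).hom ≫ z.arrow ◁ β ≫ (Hom.tri t).inv) (whiskerRight_compat_of_pasteIso hc)
  refine ⟨⟨μ, β, ?_⟩, ⟨rfl, hom₂_ext h₀ hm.symm⟩, ?_⟩
  · change μ ▷ F.arrow ≫ _ = _
    rw [h₁]
    simp
  · rintro μ' ⟨h₂, h₃⟩
    refine hom₂_ext (hu _ ⟨congrArg Hom₂.upper h₃, ?_⟩) h₂
    have := Hom₂.comm μ'
    rw [h₂] at this
    change Hom₂.upper μ' ▷ F.arrow ≫ (Hom.tri t).hom = _ at this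
    rw [← cancel_mono (Hom.tri t).hom, this]
    simp

theorem existsUnique_vertical (F : BipullbackAlong x f) {z : Disp D} (s t : z ⟶ F.obj)
    (hst : Hom.lower s = Hom.lower t) (m : s ≫ F.cell ⟶ t ≫ F.cell) (hm : IsVertical m) :
    ∃! μ : s ⟶ t, IsVertical μ ∧ μ ▷ F.cell = m := by
  obtain ⟨h, hm⟩ := hm
  obtain ⟨μ, ⟨h₁, h₂⟩, hu⟩ := F.existsUnique_cell s t m (eqToHom hst)
    (by rw [hm, eqToHom_whiskerRight]; rfl)
  refine ⟨μ, ⟨⟨hst, h₁⟩, h₂⟩, ?_⟩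
  rintro μ' ⟨⟨_, h₁'⟩, h₂'⟩
  exact hu μ' ⟨h₁', h₂'⟩

theorem exists_vertical_iso (F : BipullbackAlong x f) {z : Disp D} (s t : z ⟶ F.obj)
    (hst : Hom.lower s = Hom.lower t) (m : s ≫ F.cell ≅ t ≫ F.cell) (hm : IsVertical m.hom) :
    ∃ μ : s ≅ t, IsVertical μ.hom ∧ μ.hom ▷ F.cell = m.hom := by
  obtain ⟨μ, ⟨h₁, h₂⟩, -⟩ := F.existsUnique_vertical s t hst m.hom hm
  obtain ⟨ν, ⟨h₁', h₂'⟩, -⟩ := F.existsUnique_vertical t s hst.symm m.inv hm.inv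
  refine ⟨⟨μ, ν, ?_, ?_⟩, h₁, h₂⟩
  · exact (F.existsUnique_vertical s s rfl (𝟙 _) ⟨rfl, rfl⟩).unique
      ⟨h₁.comp h₁', by simp [h₂, h₂']⟩ ⟨⟨rfl, rfl⟩, by simp⟩
  · exact (F.existsUnique_vertical t t rfl (𝟙 _) ⟨rfl, rfl⟩).unique
      ⟨h₁'.comp h₁, by simp [h₂, h₂']⟩ ⟨⟨rfl, rfl⟩, by simp⟩

open Limits in
-- Faithfulness and fullness are the 2-dimensional universal property, essential surjectivity the
-- 1-dimensional one.
theorem isCartesianOneCell (F : BipullbackAlong x f) : IsCartesianOneCell (cod D) F.cell := by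
  intro z
  refine { faithful := ⟨?_⟩, full := ⟨?_⟩, essSurj := ⟨?_⟩ }
  · intro s t μ ν h
    have h₁ : Hom₂.lower μ = Hom₂.lower ν := congrArg CategoricalPullback.Hom.fst h
    have h₂ : μ ▷ F.cell = ν ▷ F.cell := congrArg CategoricalPullback.Hom.snd h
    exact (F.existsUnique_cell s t (μ ▷ F.cell) (Hom₂.lower μ) rfl).unique ⟨rfl, rfl⟩
      ⟨h₁.symm, h₂.symm⟩
  · intro s t m
    have hw : CategoricalPullback.Hom.fst m ▷ f ≫ 𝟙 _ =
        𝟙 _ ≫ Hom₂.lower (CategoricalPullback.Hom.snd m) := m.w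
    rw [Category.id_comp] at hw
    obtain ⟨μ, ⟨h₁, h₂⟩, -⟩ := F.existsUnique_cell s t m.snd m.fst
      (hw.symm.trans (Category.comp_id _))
    exact ⟨μ, CategoricalPullback.Hom.ext h₁ h₂⟩
  · intro p
    obtain ⟨t, ht, e, he⟩ := F.exists_lift_of_iso p.snd p.fst p.iso
    refine ⟨t, ⟨CategoricalPullback.mkIso (eqToIso ht) e ?_⟩⟩
    change eqToHom ht ▷ f ≫ p.iso.hom = 𝟙 _ ≫ Hom₂.lower e.hom
    refine (congrArg (· ≫ p.iso.hom) (eqToHom_whiskerRight ht f)).trans ?_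
    rw [he]
    exact (Category.id_comp _).symm

end BipullbackAlong

/-! ### Bicarrable 1-cells form a display class -/

section Pasting

variable {K : Type u} [Bicategory.{w, v} K]

theorem isBipullback_id {a c : K} (f : c ⟶ a) :
    IsBipullback (𝟙 a) f f (𝟙 c) (ρ_ f ≪≫ (λ_ f).symm) where
  exists_factor {X} l₀ l₁ l := by
    refine ⟨l₁, l.symm ≪≫ ρ_ l₀, ρ_ l₁, ?_⟩
    simp
  existsUnique_cell {X} s t a₀ a₁ h := by
    -- The projection to `c` is an identity, so `a₁` already determines the 2-cell; the
    -- compatibility condition then forces `a₀`.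
    refine ⟨(ρ_ s).inv ≫ a₁ ≫ (ρ_ t).hom, ⟨?_, by simp⟩, ?_⟩
    · have h' : a₀ ▷ 𝟙 a ≫ (α_ t f (𝟙 a)).hom ≫ t ◁ (ρ_ f).hom =
          (α_ s f (𝟙 a)).hom ≫ s ◁ (ρ_ f).hom ≫ s ◁ (λ_ f).inv ≫ (α_ s (𝟙 c) f).inv ≫
            a₁ ▷ f ≫ (α_ t (𝟙 c) f).hom ≫ t ◁ (λ_ f).hom := by
        have := h =≫ t ◁ (λ_ f).hom
        simpa using this
      have e₁ : a₀ ▷ 𝟙 a ≫ (α_ t f (𝟙 a)).hom ≫ t ◁ (ρ_ f).hom = (ρ_ (s ≫ f)).hom ≫ a₀ := by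
        simp
      have e₂ : s ◁ (λ_ f).inv ≫ (α_ s (𝟙 c) f).inv ≫ a₁ ▷ f ≫ (α_ t (𝟙 c) f).hom ≫
          t ◁ (λ_ f).hom = ((ρ_ s).inv ≫ a₁ ≫ (ρ_ t).hom) ▷ f := by
        simp
      have e₃ : (α_ s f (𝟙 a)).hom ≫ s ◁ (ρ_ f).hom = (ρ_ (s ≫ f)).hom := by simp
      rw [e₁, e₂, reassoc_of% e₃, cancel_epi] at h'
      exact h'.symm
    · rintro b ⟨-, rfl⟩
      simp

theorem IsBipullback.exists_iso {A B C P X : K} {x : A ⟶ B} {f : C ⟶ B} {d₀ : P ⟶ A}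
    {d₁ : P ⟶ C} {π : d₀ ≫ x ≅ d₁ ≫ f} (hP : IsBipullback x f d₀ d₁ π) (s t : X ⟶ P)
    (a₀ : s ≫ d₀ ≅ t ≫ d₀) (a₁ : s ≫ d₁ ≅ t ≫ d₁)
    (h : a₀.hom ▷ x ≫ (α_ t d₀ x).hom ≫ t ◁ π.hom =
      (α_ s d₀ x).hom ≫ s ◁ π.hom ≫ (α_ s d₁ f).inv ≫ a₁.hom ▷ f ≫ (α_ t d₁ f).hom) :
    ∃ b : s ≅ t, b.hom ▷ d₀ = a₀.hom ∧ b.hom ▷ d₁ = a₁.hom := by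
  have h' : a₀.inv ▷ x ≫ (α_ s d₀ x).hom ≫ s ◁ π.hom =
      (α_ t d₀ x).hom ≫ t ◁ π.hom ≫ (α_ t d₁ f).inv ≫ a₁.inv ▷ f ≫ (α_ s d₁ f).hom := by
    rw [← cancel_epi (a₀.hom ▷ x), reassoc_of% h]
    simp
  obtain ⟨b, ⟨h₀, h₁⟩, -⟩ := hP.existsUnique_cell s t a₀.hom a₁.hom h
  obtain ⟨c, ⟨k₀, k₁⟩, -⟩ := hP.existsUnique_cell t s a₀.inv a₁.inv h'
  refine ⟨⟨b, c, ?_, ?_⟩, h₀, h₁⟩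
  · exact (hP.existsUnique_cell s s (𝟙 _) (𝟙 _) (by simp)).unique
      ⟨by simp [h₀, k₀], by simp [h₁, k₁]⟩ ⟨by simp, by simp⟩
  · exact (hP.existsUnique_cell t t (𝟙 _) (𝟙 _) (by simp)).unique
      ⟨by simp [h₀, k₀], by simp [h₁, k₁]⟩ ⟨by simp, by simp⟩

/-- The cancellation half of the pasting law. An iso-cone over `d₁` and `k`, pasted with the square
of `P`, becomes one over `x` and `k ≫ f` and so factors through `Q`; the factorization is compared
with the original cone by testing in `P`. For 2-cells, existence and uniqueness come from `Q`, and
`P` identifies the result after `t`. -/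
theorem IsBipullback.exists_pasting {A B C P E Q : K} {x : A ⟶ B} {f : C ⟶ B} {d₀ : P ⟶ A}
    {d₁ : P ⟶ C} {π : d₀ ≫ x ≅ d₁ ≫ f} (hP : IsBipullback x f d₀ d₁ π) (k : E ⟶ C)
    {q₀ : Q ⟶ A} {q₁ : Q ⟶ E} {κ : q₀ ≫ x ≅ q₁ ≫ k ≫ f}
    (hQ : IsBipullback x (k ≫ f) q₀ q₁ κ) :
    ∃ (t : Q ⟶ P) (γ : t ≫ d₁ ≅ q₁ ≫ k), IsBipullback d₁ k t q₁ γ := by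
  obtain ⟨t, γ₀, γ₁, ht⟩ := hP.exists_factor q₀ (q₁ ≫ k) (κ ≪≫ (α_ _ _ _).symm)
  have hκ : κ.hom = γ₀.inv ▷ x ≫ (α_ _ _ _).hom ≫ t ◁ π.hom ≫ (α_ _ _ _).inv ≫ γ₁.hom ▷ f ≫
      (α_ _ _ _).hom := by
    rw [reassoc_of% ht]
    simp
  -- Conjugation by `γ₀` passes between conditions on `q₀`, where `Q` is tested, and conditions on
  -- `t ≫ d₀`, where `P` is tested.
  have hab : ∀ {X : K} {s r : X ⟶ Q} (b : s ⟶ r) (a : s ≫ t ⟶ r ≫ t),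
      b ▷ q₀ = s ◁ γ₀.inv ≫ (α_ _ _ _).inv ≫ a ▷ d₀ ≫ (α_ _ _ _).hom ≫ r ◁ γ₀.hom ↔
        (b ▷ t) ▷ d₀ = a ▷ d₀ := by
    intro X s r b a
    have e : b ▷ q₀ = s ◁ γ₀.inv ≫ (α_ _ _ _).inv ≫ (b ▷ t) ▷ d₀ ≫ (α_ _ _ _).hom ≫
        r ◁ γ₀.hom := by
      have e₁ := whiskerRight_comp b t d₀
      rw [← reassoc_of% e₁, ← whisker_exchange, ← whiskerLeft_comp_assoc]
      simp
    rw [e, cancel_epi, cancel_epi, cancel_mono]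
  have hex : ∀ {X : K} {s r : X ⟶ Q} (a : s ≫ t ⟶ r ≫ t),
      a ▷ d₀ ▷ x ≫ (α_ (r ≫ t) d₀ x).hom ≫ (r ≫ t) ◁ π.hom =
        (α_ (s ≫ t) d₀ x).hom ≫ (s ≫ t) ◁ π.hom ≫ (α_ (s ≫ t) d₁ f).inv ≫ a ▷ d₁ ▷ f ≫
          (α_ (r ≫ t) d₁ f).hom := by
    intro X s r a
    have e₁ : a ▷ d₀ ▷ x ≫ (α_ (r ≫ t) d₀ x).hom = (α_ (s ≫ t) d₀ x).hom ≫ a ▷ (d₀ ≫ x) := by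
      rw [whiskerRight_comp, Iso.hom_inv_id_assoc]
    have e₂ : (α_ (s ≫ t) d₁ f).inv ≫ a ▷ d₁ ▷ f ≫ (α_ (r ≫ t) d₁ f).hom =
        a ▷ (d₁ ≫ f) := by rw [whiskerRight_comp]
    rw [reassoc_of% e₁, e₂, whisker_exchange]
  refine ⟨t, γ₁, ?_, ?_⟩
  · intro X l₀ l₁ l
    obtain ⟨s, δ₀, δ₁, hs⟩ := hQ.exists_factor (l₀ ≫ d₀) l₁ (Disp.pasteIso l π)
    obtain ⟨c, hc₀, hc₁⟩ := hP.exists_iso (s ≫ t) l₀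
      (α_ _ _ _ ≪≫ whiskerLeftIso s γ₀ ≪≫ δ₀)
      (α_ _ _ _ ≪≫ whiskerLeftIso s γ₁ ≪≫ (α_ _ _ _).symm ≪≫ whiskerRightIso δ₁ k ≪≫ l.symm) (by
        have hs' : δ₀.hom ▷ x ≫ (α_ _ _ _).hom ≫ l₀ ◁ π.hom = (α_ _ _ _).hom ≫ s ◁ κ.hom ≫
            (α_ _ _ _).inv ≫ δ₁.hom ▷ (k ≫ f) ≫ (α_ _ _ _).inv ≫ l.inv ▷ f ≫ (α_ _ _ _).hom := by
          rw [reassoc_of% hs]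
          simp [Disp.pasteIso]
        simp only [Iso.trans_hom, comp_whiskerRight, Category.assoc]
        rw [hs', hκ]
        simp)
    refine ⟨s, c, δ₁, ?_⟩
    rw [hc₁]
    simp
  · intro X s r a₀ a₁ h
    obtain ⟨b, ⟨h₀, h₁⟩, hu⟩ := hQ.existsUnique_cell s r
      (s ◁ γ₀.inv ≫ (α_ _ _ _).inv ≫ a₀ ▷ d₀ ≫ (α_ _ _ _).hom ≫ r ◁ γ₀.hom) a₁ (by
        have e₁ := hex a₀
        have e₂ := congrArg (· ▷ f) h
        simp only [comp_whiskerRight] at e₂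
        have e₃ : (s ◁ γ₀.inv ≫ (α_ _ _ _).inv ≫ a₀ ▷ d₀ ≫ (α_ _ _ _).hom ≫ r ◁ γ₀.hom) ▷ x ≫
            (α_ _ _ _).hom ≫ r ◁ κ.hom =
              (s ◁ γ₀.inv) ▷ x ≫ (α_ _ _ _).inv ▷ x ≫ (a₀ ▷ d₀ ▷ x ≫ (α_ (r ≫ t) d₀ x).hom ≫
                (r ≫ t) ◁ π.hom) ≫ (α_ _ _ _).inv ≫ (α_ r t d₁).hom ▷ f ≫ (r ◁ γ₁.hom) ▷ f ≫
                  (α_ _ _ _).hom ≫ r ◁ (α_ _ _ _).hom := by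
          rw [hκ]
          simp
        rw [e₃, e₁]
        simp only [Category.assoc, Iso.hom_inv_id_assoc]
        rw [reassoc_of% e₂, hκ]
        simp)
    rw [hab] at h₀
    have h₂ : (b ▷ t) ▷ d₁ = a₀ ▷ d₁ := by
      rw [← cancel_mono ((α_ _ _ _).hom ≫ r ◁ γ₁.hom), h, ← h₁]
      have e₁ : b ▷ t ▷ d₁ ≫ (α_ _ _ _).hom = (α_ _ _ _).hom ≫ b ▷ (t ≫ d₁) := by
        rw [whiskerRight_comp, Iso.hom_inv_id_assoc]
      rw [reassoc_of% e₁, ← whisker_exchange, whiskerRight_comp]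
    refine ⟨b, ⟨?_, h₁⟩, ?_⟩
    · refine (hP.existsUnique_cell (s ≫ t) (r ≫ t) (a₀ ▷ d₀) (a₀ ▷ d₁) ?_).unique
        ⟨h₀, h₂⟩ ⟨rfl, rfl⟩
      exact hex a₀
    · rintro b' ⟨rfl, h₁'⟩
      exact hu b' ⟨(hab _ _).2 rfl, h₁'⟩

/-- A bipullback of `x` along `k ≫ f` is, by cancellation, a bipullback along `k` of the projection
from the bipullback along `f`; hence that projection is bicarrable. -/
theorem isDisplayClass_bicarrable : IsDisplayClass (Bicarrable (K := K)) where
  bicarrable _ _ _ hx := hx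
  id_mem _ _ f := ⟨_, _, _, _, isBipullback_id f⟩
  bipullback_mem a b c x f hx := by
    obtain ⟨p, f', y, π, h⟩ := hx f
    refine ⟨p, f', y, π, h, ?_⟩
    intro e k
    obtain ⟨q, q₀, q₁, κ, hq⟩ := hx (k ≫ f)
    obtain ⟨t, γ, ht⟩ := h.exists_pasting k hq
    exact ⟨_, _, _, _, ht⟩

end Pasting

open Disp

variable {K : Type u} [Bicategory.{w, v} K] {D : CellClass K}

theorem IsDisplayClass.nonempty_bipullbackAlong (hD : IsDisplayClass D) (x : Disp D) {b : K}
    (f : b ⟶ x.bot) : Nonempty (BipullbackAlong x f) := by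
  obtain ⟨p, f', y, π, h, hy⟩ := hD.bipullback_mem x.arrow f x.mem
  exact ⟨⟨p, y, hy, f', π, h⟩⟩

/-! ### From fibrational objects to the Johnstone criterion -/

section OfFibrational

variable {x : Disp D}

theorem IsFibrational.isCart_whiskerLeft (hx : IsFibrational (cod D) x) {z y : Disp D}
    (k : z ⟶ y) {f g : y ⟶ x} {a : f ⟶ g} (ha : IsCart a) : IsCart (k ◁ a) :=
  (isCartesianTwoCell_iff _).1 (hx.whisker k a ((isCartesianTwoCell_iff _).2 ha))

/-- Common source of the iso-2-cells `τ` and `θ`: cartesian lifts of one 2-cell are vertically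
isomorphic, and the iso descends along the square `F`. -/
theorem BipullbackAlong.exists_iso_of_isCart {b : K} {f : b ⟶ x.bot} (F : BipullbackAlong x f)
    {z : Disp D} {s t : z ⟶ F.obj} (hst : Hom.lower s = Hom.lower t) {g : z ⟶ x}
    {c : s ≫ F.cell ⟶ g} {c' : t ≫ F.cell ⟶ g} (hc : IsCart c) (hc' : IsCart c')
    {p q : z.bot ⟶ x.bot} {φ : p ⟶ q} (hφ : LiesOver c φ) (hφ' : LiesOver c' φ) :
    ∃ τ : s ≅ t, IsVertical τ.hom ∧ τ.hom ▷ F.cell ≫ c' = c := by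
  obtain ⟨e, he, hec⟩ := hc.exists_iso hc' hφ hφ'
  obtain ⟨τ, hτ, hτe⟩ := F.exists_vertical_iso s t hst e he
  exact ⟨τ, hτ, by rw [hτe, hec]⟩

variable [Strict K]

theorem IsFibrational.exists_lift (hx : IsFibrational (cod D) x) {b : K} {f g : b ⟶ x.bot}
    (F : BipullbackAlong x f) (G : BipullbackAlong x g) (a : f ⟶ g) :
    ∃ (r : G.obj ⟶ F.obj) (l : r ≫ F.cell ⟶ G.cell),
      Hom.lower r = 𝟙 b ∧ LiesOver l a ∧ IsCart l := by
  have hfib := hx.isFibered G.obj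
  obtain ⟨h, l, hl⟩ := hfib.exists_isCartesian' (a := G.cell) a
  obtain ⟨hla, hlc⟩ := (isStronglyCartesian_iff a l).1
    (@Functor.IsFibered.isStronglyCartesian_of_isCartesian _ _ _ _ _ hfib _ _ a _ _ l hl)
  obtain ⟨r, e, hr, he⟩ := F.exists_lift h (𝟙 b) (hla.choose.trans (Strict.id_comp f).symm)
  exact ⟨r, e.hom ≫ l, hr, he.comp_liesOver hla, (IsCart.of_isIso e).comp hlc⟩

theorem IsFibrational.nonempty_johnstoneStructure (hx : IsFibrational (cod D) x) :
    Nonempty (JohnstoneStructure x) := by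
  choose r l hr hl hc using
    fun (b : K) (f g : b ⟶ x.bot) (F : BipullbackAlong x f) (G : BipullbackAlong x g)
      (a : f ⟶ g) => hx.exists_lift F G a
  refine ⟨{ r := fun F G a => r _ _ _ F G a
            r_vertical := fun F G a => hr _ _ _ F G a
            lift := fun F G a => l _ _ _ F G a
            lift_over := fun F G a => hl _ _ _ F G a
            comp := ?_, id := ?_, whisker := ?_, factor := ?_ }⟩
  · intro b f g h F G H a a'
    obtain ⟨τ, hτ, hτl⟩ := F.exists_iso_of_isCart
      (s := r _ _ _ G H a' ≫ r _ _ _ F G a) (t := r _ _ _ F H (a ≫ a'))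
      (c := (α_ _ _ _).hom ≫ r _ _ _ G H a' ◁ l _ _ _ F G a ≫ l _ _ _ G H a')
      (by rw [lower_comp, hr, hr, hr]; exact Strict.id_comp _)
      ((IsCart.of_isIso (α_ _ _ _)).comp ((hx.isCart_whiskerLeft _ (hc _ _ _ F G a)).comp
        (hc _ _ _ G H a'))) (hc _ _ _ F H (a ≫ a'))
      ((isVertical_associator_hom _ _ _).comp_liesOver
        (((hl _ _ _ F G a).id_whiskerLeft (hr _ _ _ G H a')).comp (hl _ _ _ G H a')))
      (hl _ _ _ F H (a ≫ a'))
    exact ⟨τ, hτ, by rw [← hτl]; simp⟩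
  · intro b f F
    obtain ⟨τ, hτ, hτl⟩ := F.exists_iso_of_isCart (s := 𝟙 F.obj) (t := r _ _ _ F F (𝟙 f))
      (hr _ _ _ F F (𝟙 f)).symm (IsCart.of_isIso (λ_ F.cell)) (hc _ _ _ F F (𝟙 f))
      ((isVertical_leftUnitor_hom F.cell).liesOver (Strict.id_comp f)) (hl _ _ _ F F (𝟙 f))
    exact ⟨τ, hτ, by rw [← hτl]; simp⟩
  · intro c b k f g F G F' G' a kf kg hkf hkg ρ π hρ hπ
    obtain ⟨θ, hθ, hθl⟩ := F.exists_iso_of_isCart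
      (s := r _ _ _ F' G' (k ◁ a) ≫ kf) (t := kg ≫ r _ _ _ F G a)
      (c := (α_ _ _ _).hom ≫ r _ _ _ F' G' (k ◁ a) ◁ ρ.hom ≫ l _ _ _ F' G' (k ◁ a))
      (c' := (α_ _ _ _).hom ≫ kg ◁ l _ _ _ F G a ≫ π.hom)
      (by rw [lower_comp, lower_comp, hr, hr, hkf, hkg]
          exact (Strict.id_comp k).trans (Strict.comp_id k).symm)
      ((IsCart.of_isIso (α_ _ _ _)).comp ((IsCart.of_isIso (whiskerLeftIso _ ρ)).comp
        (hc _ _ _ F' G' (k ◁ a))))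
      ((IsCart.of_isIso (α_ _ _ _)).comp ((hx.isCart_whiskerLeft _ (hc _ _ _ F G a)).comp
        (IsCart.of_isIso π)))
      ((isVertical_associator_hom _ _ _).comp_liesOver
        ((hρ.whiskerLeft _).comp_liesOver (hl _ _ _ F' G' (k ◁ a))))
      ((isVertical_associator_hom _ _ _).comp_liesOver
        (((hl _ _ _ F G a).whiskerLeft hkg).comp_isVertical hπ))
    exact ⟨θ, hθ, by rw [hθl]; simp⟩
  · intro b f g F G a t y hy v₀ v₁ hv₀ hv₁ a₀ ha₀
    have hcart := (IsCart.of_isIso (α_ v₁ (r _ _ _ F G a) F.cell)).comp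
      (hx.isCart_whiskerLeft v₁ (hc _ _ _ F G a))
    have hover := (isVertical_associator_hom v₁ (r _ _ _ F G a) F.cell).comp_liesOver
      ((hl _ _ _ F G a).id_whiskerLeft hv₁)
    -- Factoring `a₀` over an identity makes `m` vertical, so that it comes from a unique vertical
    -- 2-cell into `v₁ ≫ r`.
    obtain ⟨m, ⟨hm, hma⟩, hu⟩ := hcart.existsUnique hover a₀ (𝟙 _) (by simpa using ha₀)
    obtain ⟨μ, ⟨hμ, hμm⟩, hu'⟩ := F.existsUnique_vertical v₀ (v₁ ≫ r _ _ _ F G a)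
      (by rw [lower_comp, hv₀, hv₁, hr]; exact (Strict.id_comp _).symm) m hm.isVertical
    refine ⟨μ, ⟨hμ, by rw [hμm, hma]⟩, ?_⟩
    rintro μ' ⟨hμ', hμa⟩
    exact hu' μ' ⟨hμ', hu _ ⟨(hμ'.whiskerRight _).liesOver ha₀.choose, hμa⟩⟩

end OfFibrational

/-! ### From the Johnstone criterion to fibrational objects -/

namespace JohnstoneStructure

variable [Strict K] {x : Disp D}

/-- Write the domain of a test 2-cell over `β' ≫ a` as `v₀ ≫ H.cell`, with `H` a bipullback and `v₀`
vertical. The factorization law for `β' ≫ a` gives a unique `μ`, and the composition law converts it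
into a 2-cell into `(v₁ ≫ r a) ≫ r β'`; whiskering and pasting with the lift of `β'` gives the
factorization. For uniqueness, the law for `β'` presents every competitor by some `ν`, and all these
`ν` correspond to the same `μ`. -/
theorem isCart_whiskerLeft_lift_of_vertical (S : JohnstoneStructure x) (hD : IsDisplayClass D) {b : K} {f g : b ⟶ x.bot}
    (F : BipullbackAlong x f) (G : BipullbackAlong x g) (a : f ⟶ g) {t : K} {y : t ⟶ b}
    {hy : D y} (v₁ : (⟨t, b, y, hy⟩ : Disp D) ⟶ G.obj) (hv₁ : Hom.lower v₁ = 𝟙 b) :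
    IsCart (v₁ ◁ S.lift F G a) := by
  have hover : LiesOver (v₁ ◁ S.lift F G a) a := (S.lift_over F G a).id_whiskerLeft hv₁
  intro h c β hc
  have hlow : Hom.lower (v₁ ≫ S.r F G a ≫ F.cell) = f := hover.choose
  obtain ⟨β', rfl⟩ : ∃ β' : Hom.lower h ⟶ f, β = β' ≫ eqToHom hlow.symm :=
    ⟨β ≫ eqToHom hlow, by rw [Category.assoc, eqToHom_trans, eqToHom_refl, Category.comp_id]⟩
  obtain ⟨H⟩ := hD.nonempty_bipullbackAlong x (Hom.lower h)
  obtain ⟨v₀, e, hv₀, he⟩ := H.exists_lift h (𝟙 b) (Strict.id_comp _).symm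
  obtain ⟨τ, hτ, hτl⟩ := S.comp H F G β' a
  -- Under `τ`, pasting with the lift of the composite equals pasting with the lifts of `β'` and `a`
  -- in succession.
  have hkey : ∀ ν : v₀ ⟶ (v₁ ≫ S.r F G a) ≫ S.r H F β',
      (ν ≫ (α_ _ _ _).hom ≫ v₁ ◁ τ.hom) ▷ H.cell ≫ (α_ _ _ _).hom ≫
        v₁ ◁ S.lift H G (β' ≫ a) =
      (ν ▷ H.cell ≫ (α_ _ _ _).hom ≫ (v₁ ≫ S.r F G a) ◁ S.lift H F β') ≫ (α_ _ _ _).hom ≫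
        v₁ ◁ S.lift F G a := by
    intro ν
    rw [← hτl]
    simp
  have hcover : LiesOver c (β' ≫ a) := hover.of_lower_eq_comp hlow hc
  obtain ⟨μ, ⟨hμ, hμc⟩, hu⟩ := S.factor H G (β' ≫ a) y hy v₀ v₁ hv₀ hv₁ (e.hom ≫ c)
    (he.comp_liesOver hcover)
  have hv : Hom.lower (v₁ ≫ S.r F G a) = 𝟙 b := by
    rw [lower_comp, hv₁, S.r_vertical]
    exact Strict.id_comp _
  refine existsUnique_of_exists_of_unique ?_ ?_
  · refine ⟨e.inv ≫ ((μ ≫ v₁ ◁ τ.inv ≫ (α_ _ _ _).inv) ▷ H.cell ≫ (α_ _ _ _).hom ≫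
      (v₁ ≫ S.r F G a) ◁ S.lift H F β') ≫ (α_ _ _ _).hom, ?_, ?_⟩
    · have hl : LiesOver (e.inv ≫ ((μ ≫ v₁ ◁ τ.inv ≫ (α_ _ _ _).inv) ▷ H.cell ≫
          (α_ _ _ _).hom ≫ (v₁ ≫ S.r F G a) ◁ S.lift H F β') ≫ (α_ _ _ _).hom) β' :=
        he.inv.comp_liesOver ((((hμ.comp ((hτ.inv.whiskerLeft v₁).comp
          (isVertical_associator_inv _ _ _))).whiskerRight H.cell).comp_liesOver
            ((isVertical_associator_hom _ _ _).comp_liesOver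
              ((S.lift_over H F β').id_whiskerLeft hv))).comp_isVertical
                (isVertical_associator_hom _ _ _))
      obtain ⟨_, _, hl⟩ := hl
      rw [hl, eqToHom_refl, Category.id_comp]
    · have := hkey (μ ≫ v₁ ◁ τ.inv ≫ (α_ _ _ _).inv)
      rw [Category.assoc, Category.assoc, ← this, Iso.inv_comp_eq, ← hμc]
      simp
  · have hfac : ∀ χ : h ⟶ v₁ ≫ S.r F G a ≫ F.cell, Hom₂.lower χ = β' ≫ eqToHom hlow.symm →
        ∃ ν : v₀ ⟶ (v₁ ≫ S.r F G a) ≫ S.r H F β', IsVertical ν ∧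
          ν ▷ H.cell ≫ (α_ _ _ _).hom ≫ (v₁ ≫ S.r F G a) ◁ S.lift H F β' =
            e.hom ≫ χ ≫ (α_ _ _ _).inv := by
      intro χ hχ
      have hl : LiesOver χ β' := ⟨rfl, hlow, by rw [hχ, eqToHom_refl, Category.id_comp]⟩
      exact (S.factor H F β' y hy v₀ (v₁ ≫ S.r F G a) hv₀ hv _
        (he.comp_liesOver (hl.comp_isVertical (isVertical_associator_inv _ _ _)))).exists
    have hν : ∀ (χ : h ⟶ v₁ ≫ S.r F G a ≫ F.cell) (ν : v₀ ⟶ (v₁ ≫ S.r F G a) ≫ S.r H F β'),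
        χ ≫ v₁ ◁ S.lift F G a = c → IsVertical ν →
        ν ▷ H.cell ≫ (α_ _ _ _).hom ≫ (v₁ ≫ S.r F G a) ◁ S.lift H F β' =
          e.hom ≫ χ ≫ (α_ _ _ _).inv → ν ≫ (α_ _ _ _).hom ≫ v₁ ◁ τ.hom = μ := by
      intro χ ν hχ hν hνχ
      refine hu _ ⟨hν.comp ((isVertical_associator_hom _ _ _).comp (hτ.whiskerLeft v₁)), ?_⟩
      rw [hkey, hνχ, ← hχ]
      simp
    rintro χ₁ χ₂ ⟨h₁, h₁'⟩ ⟨h₂, h₂'⟩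
    obtain ⟨ν₁, hν₁, hχ₁⟩ := hfac χ₁ h₁
    obtain ⟨ν₂, hν₂, hχ₂⟩ := hfac χ₂ h₂
    have hνν := (hν χ₁ ν₁ h₁' hν₁ hχ₁).trans (hν χ₂ ν₂ h₂' hν₂ hχ₂).symm
    rw [cancel_mono] at hνν
    subst hνν
    rwa [hχ₁, cancel_epi, cancel_mono] at hχ₂

/-- Up to isomorphism `u` is `v' ≫ kg` with `v'` vertical and `kg` between bipullbacks. The
whiskering law identifies `kg ◁ lift`, up to isos, with the lift of the whiskered 2-cell, which
leaves the vertical case. -/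
theorem isCart_whiskerLeft_lift (S : JohnstoneStructure x) (hD : IsDisplayClass D) {b : K} {f g : b ⟶ x.bot}
    (F : BipullbackAlong x f) (G : BipullbackAlong x g) (a : f ⟶ g) {z : Disp D}
    (u : z ⟶ G.obj) : IsCart (u ◁ S.lift F G a) := by
  obtain ⟨F'⟩ := hD.nonempty_bipullbackAlong x (Hom.lower u ≫ f)
  obtain ⟨G'⟩ := hD.nonempty_bipullbackAlong x (Hom.lower u ≫ g)
  obtain ⟨kf, ρ, hkf, hρ⟩ := F.exists_lift F'.cell (Hom.lower u) rfl
  obtain ⟨kg, π, hkg, hπ⟩ := G.exists_lift G'.cell (Hom.lower u) rfl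
  obtain ⟨v', e, hv', he⟩ := G'.exists_lift (u ≫ G.cell) (𝟙 z.bot) (Strict.id_comp _).symm
  obtain ⟨ι, hι, -⟩ := G.exists_vertical_iso (v' ≫ kg) u
    (by rw [lower_comp, hv', hkg]; exact Strict.id_comp _)
    (α_ _ _ _ ≪≫ whiskerLeftIso v' π ≪≫ e)
    ((isVertical_associator_hom _ _ _).comp ((hπ.whiskerLeft v').comp he))
  obtain ⟨θ, hθ, hθl⟩ := S.whisker (Hom.lower u) F G F' G' a kf kg hkf hkg ρ π hρ hπ
  have h₁ : kg ◁ S.lift F G a = ((whiskerLeftIso (S.r F' G' (Hom.lower u ◁ a)) ρ.symm ≪≫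
      (α_ _ _ _).symm ≪≫ whiskerRightIso θ F.cell ≪≫ α_ _ _ _).symm).hom ≫
        S.lift F' G' (Hom.lower u ◁ a) ≫ π.symm.hom := by
    rw [← hθl]
    simp
  have h₂ : u ◁ S.lift F G a = (whiskerRightIso ι.symm (S.r F G a ≫ F.cell) ≪≫ α_ _ _ _).hom ≫
      v' ◁ (kg ◁ S.lift F G a) ≫ ((α_ _ _ _).symm ≪≫ whiskerRightIso ι G.cell).hom := by
    have h₃ := comp_whiskerLeft v' kg (S.lift F G a)
    have h₄ := whisker_exchange ι.hom (S.lift F G a)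
    rw [h₃] at h₄
    simp only [Iso.trans_hom, whiskerRightIso_hom, Iso.symm_hom, Category.assoc] at h₄ ⊢
    rw [← cancel_epi (ι.hom ▷ (S.r F G a ≫ F.cell)), ← h₄, hom_inv_whiskerRight_assoc]
  rw [h₂, h₁, whiskerLeft_comp, whiskerLeft_comp]
  exact (IsCart.of_isIso _).comp (((IsCart.of_isIso (whiskerLeftIso v' _)).comp
    ((S.isCart_whiskerLeft_lift_of_vertical hD F' G' _ v' hv').comp
      (IsCart.of_isIso (whiskerLeftIso v' _)))).comp (IsCart.of_isIso _))

/-- The Johnstone structure yields cartesian lifts whose whiskerings are cartesian. -/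
theorem exists_lift (S : JohnstoneStructure x) (hD : IsDisplayClass D) {y : Disp D} (g : y ⟶ x) {f : y.bot ⟶ x.bot}
    (a : f ⟶ Hom.lower g) : ∃ (h : y ⟶ x) (l : h ⟶ g), LiesOver l a ∧ IsCart l ∧
      ∀ {z : Disp D} (k : z ⟶ y), IsCart (k ◁ l) := by
  obtain ⟨F⟩ := hD.nonempty_bipullbackAlong x f
  obtain ⟨G⟩ := hD.nonempty_bipullbackAlong x (Hom.lower g)
  obtain ⟨v, e, hv, he⟩ := G.exists_lift g (𝟙 y.bot) (Strict.id_comp _).symm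
  refine ⟨v ≫ S.r F G a ≫ F.cell, v ◁ S.lift F G a ≫ e.hom,
    ((S.lift_over F G a).id_whiskerLeft hv).comp_isVertical he,
    (S.isCart_whiskerLeft_lift hD F G a v).comp (IsCart.of_isIso e), ?_⟩
  intro z k
  -- Up to isos this is the whiskering of the lift with `k ≫ v`, which need not be vertical.
  have h₁ : k ◁ (v ◁ S.lift F G a ≫ e.hom) = (α_ _ _ _).symm.hom ≫
      (k ≫ v) ◁ S.lift F G a ≫ (α_ _ _ _ ≪≫ whiskerLeftIso k e).hom := by
    simp
  rw [h₁]
  exact (IsCart.of_isIso _).comp ((S.isCart_whiskerLeft_lift hD F G a (k ≫ v)).comp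
    (IsCart.of_isIso _))

theorem isFibrational (S : JohnstoneStructure x) (hD : IsDisplayClass D) : IsFibrational (cod D) x where
  exists_cartesian_lift f := by
    obtain ⟨F⟩ := hD.nonempty_bipullbackAlong x f
    exact ⟨F.obj, F.cell, rfl, F.isCartesianOneCell⟩
  isFibered y := Functor.IsFibered.of_exists_isStronglyCartesian fun g f a => by
    obtain ⟨h, l, hl, hc, -⟩ := S.exists_lift hD g a
    exact ⟨h, l, (isStronglyCartesian_iff a l).2 ⟨hl, hc⟩⟩
  whisker {z y} k {f g} a ha := by
    rw [isCartesianTwoCell_iff] at ha ⊢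
    obtain ⟨h, l, hl, hc, hk⟩ := S.exists_lift hD g (Hom₂.lower a)
    -- An arbitrary cartesian 2-cell is an iso followed by the constructed lift of its lower
    -- component, so it inherits stability under whiskering.
    obtain ⟨e, -, rfl⟩ := ha.exists_iso hc (LiesOver.self a) hl
    rw [whiskerLeft_comp]
    exact (IsCart.of_isIso (whiskerLeftIso k e)).comp (hk k)

end JohnstoneStructure

/-! ### The equivalence -/

theorem satisfiesJohnstone_iff [Strict K] (hD : IsDisplayClass D) {a b : K} (x : a ⟶ b) :
    SatisfiesJohnstone D x ↔ ∃ hx : D x, IsFibrational (cod D) ⟨a, b, x, hx⟩ :=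
  ⟨fun ⟨_, hx, ⟨S⟩⟩ => ⟨hx, S.isFibrational hD⟩,
    fun ⟨hx, h⟩ => ⟨hD.bicarrable x hx, hx, h.nonempty_johnstoneStructure⟩⟩

end JohnstoneFib

theorem mainTheorem2 {K : Type u} [Bicategory.{w, v} K] [Bicategory.Strict K] :
    (∀ {a b : K} (x : a ⟶ b),
      JohnstoneFib.SatisfiesJohnstone JohnstoneFib.Bicarrable x ↔
        ∃ hx : JohnstoneFib.Bicarrable x,
          JohnstoneFib.IsFibrational (JohnstoneFib.Disp.cod JohnstoneFib.Bicarrable)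
            ⟨a, b, x, hx⟩) ∧
    (∀ D : JohnstoneFib.CellClass K, JohnstoneFib.IsDisplayClass D → ∀ {a b : K} (x : a ⟶ b),
      JohnstoneFib.SatisfiesJohnstone D x ↔
        ∃ hx : D x, JohnstoneFib.IsFibrational (JohnstoneFib.Disp.cod D) ⟨a, b, x, hx⟩) :=
  ⟨fun x => JohnstoneFib.satisfiesJohnstone_iff JohnstoneFib.isDisplayClass_bicarrable x,
    fun _ hD _ _ x => JohnstoneFib.satisfiesJohnstone_iff hD x⟩
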